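/- For $\lambda\in\mathbb R^n$ let $\sigma_j(\lambda)$ be the $j$-th elementary symmetric function ($\sigma_0=1$ and $\sigma_j=0$ for $j>n$), for a symmetric matrix $A$ let $\sigma_j(A)=\sigma_j(\lambda(A))$, where $\lambda(A)$ is the vector of eigenvalues of $A$, and let $\Gamma_j=\{\lambda:\sigma_1(\lambda)>0,\dots,\sigma_j(\lambda)>0\}$. Put $S_k=\sigma_k+\sigma_{k-1}$ and $\tilde\Gamma_k=\Gamma_{k-1}\cap\{S_k>0\}$. A continuous function $u$ on an open set $\Omega\subset\mathbb R^n$ is a viscosity solution of $S_k(D^2u)=f$ in $\Omega$ if, for all $\varphi\in C^2(\Omega)$ and $x_0\in\Omega$: (i) $S_k(D^2\varphi(x_0))\ge f(x_0)$ whenever $u-\varphi$ has a local maximum at $x_0$; (ii) $S_k(D^2\varphi(x_0))\le f(x_0)$ whenever $u-\varphi$ has a local minimum at $x_0$ and $\lambda(D^2\varphi(x_0))\in\tilde\Gamma_k$. Write $B_r$ for the open ball of radius $r$ centred at the origin. **Theorem.** Let $n\ge 4$ and $k\ge 4$. Then there are $r>0$, a smooth function $f$ on $B_r\subset\mathbb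 R^n$ and a convex viscosity solution $u$ of $$\sigma_k(D^2u)+\sigma_{k-1}(D^2u)=f(x)\quad\text{in } B_r$$ such that $u$ is Lipschitz continuous on $B_r$, but, for some $\beta\in(0,1)$, $u\notin C^{1,\beta}(B_{r/2})$ (not even locally: it is not the case that $u$ is differentiable in $B_{r/2}$ and that $Du$ is $\beta$-Hölder continuous near each point of $B_{r/2}$). Moreover, if $k\le n+1$ (for $k>n+1$ the left-hand side of the equation is identically $0$), then this holds with $$u(x)=(1+x_1^2)\,\bigl(x_2^2+\dots+x_{k-1}^2\bigr)^{\alpha/2},\qquad \alpha=2-\frac{2}{k-1},$$ and with an $f$ that has a positive lower bound in $B_r$. -/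

import Mathlib

open scoped ContDiff

noncomputable section

namespace SumHessian

/-- The `k`-th elementary symmetric function of `v = (v₁, …, vₙ)`. It is `1` for `k = 0`
and `0` for `k > n`. -/
def sigma {n : ℕ} (k : ℕ) (v : Fin n → ℝ) : ℝ :=
  ∑ s ∈ Finset.powersetCard k (Finset.univ : Finset (Fin n)), ∏ i ∈ s, v i

/-- The sum operator `S_k = σ_k + σ_{k-1}`, for `k ≥ 1`. -/
def S {n : ℕ} (k : ℕ) (v : Fin n → ℝ) : ℝ := sigma k v + sigma (k - 1) v

/-- The Gårding cone `Γ_k`. -/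
def Gam (n k : ℕ) : Set (Fin n → ℝ) := {v | ∀ j, 1 ≤ j → j ≤ k → 0 < sigma j v}

/-- The admissible set `Γ_{k-1} ∩ {σ_k + σ_{k-1} > 0}` on which `S_k` is elliptic. -/
def GamTilde (n k : ℕ) : Set (Fin n → ℝ) := Gam n (k - 1) ∩ {v | 0 < S k v}

/-- The vector of eigenvalues, with multiplicity, of a real symmetric matrix
(and `0` for a matrix which is not symmetric). -/
def eigs {n : ℕ} (A : Matrix (Fin n) (Fin n) ℝ) : Fin n → ℝ :=
  open Classical in if h : A.IsHermitian then h.eigenvalues else 0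

/-- The Hessian matrix `D²φ(x)`, with entries `∂ᵢ∂ⱼφ(x)`. -/
def hess {n : ℕ} (φ : EuclideanSpace ℝ (Fin n) → ℝ) (x : EuclideanSpace ℝ (Fin n)) :
    Matrix (Fin n) (Fin n) ℝ :=
  Matrix.of fun i j =>
    fderiv ℝ (fderiv ℝ φ) x (EuclideanSpace.single i 1) (EuclideanSpace.single j 1)

/-- Viscosity subsolution of `S_k(D²u) = f` in the open set `Ω`: if a `C²` function `φ` touches
`u` from above at a point (up to a constant), then `S_k(D²φ) ≥ f` there. -/
def IsViscositySubsolution {n : ℕ} (k : ℕ) (Ω : Set (EuclideanSpace ℝ (Fin n)))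
    (f u : EuclideanSpace ℝ (Fin n) → ℝ) : Prop :=
  ∀ φ : EuclideanSpace ℝ (Fin n) → ℝ, ContDiffOn ℝ 2 φ Ω →
    ∀ x ∈ Ω, IsLocalMax (fun y => u y - φ y) x → f x ≤ S k (eigs (hess φ x))

/-- Viscosity supersolution of `S_k(D²u) = f` in the open set `Ω`: if a `C²` function `φ` touches
`u` from below at a point (up to a constant) and is admissible there, then `S_k(D²φ) ≤ f` there.
As always for Hessian equations, which are elliptic on admissible functions only, the test
functions from below are the admissible ones. -/
def IsViscositySupersolution {n : ℕ} (k : ℕ) (Ω : Set (EuclideanSpace ℝ (Fin n)))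
    (f u : EuclideanSpace ℝ (Fin n) → ℝ) : Prop :=
  ∀ φ : EuclideanSpace ℝ (Fin n) → ℝ, ContDiffOn ℝ 2 φ Ω →
    ∀ x ∈ Ω, IsLocalMin (fun y => u y - φ y) x → eigs (hess φ x) ∈ GamTilde n k →
      S k (eigs (hess φ x)) ≤ f x

/-- Continuous viscosity solution of `σ_k(D²u) + σ_{k-1}(D²u) = f` in the open set `Ω`. -/
structure IsViscositySolution {n : ℕ} (k : ℕ) (Ω : Set (EuclideanSpace ℝ (Fin n)))
    (f u : EuclideanSpace ℝ (Fin n) → ℝ) : Prop where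
  continuousOn : ContinuousOn u Ω
  subsolution : IsViscositySubsolution k Ω f u
  supersolution : IsViscositySupersolution k Ω f u

/-- `u ∈ C^{1,β}` locally in the open set `Ω`: `u` is differentiable in `Ω` and every point of `Ω`
has a neighbourhood on which `Du` is `β`-Hölder continuous. This class contains the functions with
finite `C^{1,β}(Ω)` norm, so that not to belong to it is the stronger assertion. -/
def IsC1Holder {n : ℕ} (β : NNReal) (Ω : Set (EuclideanSpace ℝ (Fin n)))
    (u : EuclideanSpace ℝ (Fin n) → ℝ) : Prop :=
  DifferentiableOn ℝ u Ω ∧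
    ∀ x ∈ Ω, ∃ U ∈ nhds x, ∃ C : NNReal, HolderOnWith C β (fderiv ℝ u) (U ∩ Ω)

/-- `(1 + x₁²) (x₂² + ⋯ + x_{k-1}²)^{α/2}` with `α = 2 - 2/(k-1)`. The coordinate `x_j` is
`x ⟨j - 1, _⟩`. -/
def pogorelov {n : ℕ} (hn : 0 < n) (k : ℕ) (x : EuclideanSpace ℝ (Fin n)) : ℝ :=
  (1 + x ⟨0, hn⟩ ^ 2) *
    (∑ i ∈ Finset.univ.filter (fun i : Fin n => 2 ≤ (i : ℕ) + 1 ∧ (i : ℕ) + 1 ≤ k - 1), x i ^ 2) ^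
      ((2 - 2 / ((k : ℝ) - 1)) / 2)

end SumHessian

end

noncomputable section

namespace SumHessian

open Matrix

/-! Write `x'` for the `k - 2` coordinates `x₂, …, x_{k-1}` and `q = α/2 = (k-2)/(k-1)`, and suppose
`k ≤ n + 1`. Where `x' ≠ 0`, the Hessian of `u = (1 + x₁²)|x'|^{2q}` lives in the block of `x₁` and
`x'`, of size `k - 1`. Hence `σ_k` vanishes and `σ_{k-1}` is the determinant of the block. By
homogeneity this determinant carries `|x'|` to the power `2(q(k-1) - (k-2)) = 0`, so it is a
polynomial in `x₁`, positive for small `x₁`: this is `f` (`S_eigs_pogHess`).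

Off the singular set `x' = 0`, a touching test function has Hessian above or below that of `u`,
Weyl's principle orders the eigenvalues, and monotonicity of `S_k` concludes. From above this is
trivial, as `D²u ≥ 0`. From below one starts from an admissible vector `v`: `S_k(v) = σ_k(1, v)`,
and `(1, v)` lies in `Γ_k`, where `σ_k` is increasing in each entry, a consequence of Newton's
inequality (`S_mono_of_mem_GamTilde`).

On the singular set no test occurs. From above, `u` grows like `|t|^{2q}` with `2q < 2` across the
set, too fast for a `C²` function. From below, `u = 0` on a subspace of dimension `n - (k-2)`, so
the Hessian of the test function has at most `k - 2` positive eigenvalues, while a vector of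
`Γ_{k-1}` has at least `k - 1`.

Finally, `|Du|` equals `2q t^{2q-1}` at distance `t` from the origin along an axis of `x'`, which is
not `O(t^q)` because `q < 1`; thus `β = q` serves. If `k > n + 1`, the operator is zero and the same
`u` works with `f = 0`. -/

lemma esymm_cons {R : Type*} [CommSemiring R] (a : R) (M : Multiset R) (j : ℕ) :
    (a ::ₘ M).esymm (j + 1) = M.esymm (j + 1) + a * M.esymm j := by
  simp [Multiset.esymm, Multiset.powersetCard_cons, Multiset.sum_map_mul_left]

lemma esymm_zero_right {R : Type*} [CommSemiring R] (M : Multiset R) : M.esymm 0 = 1 := by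
  simp [Multiset.esymm]

lemma esymm_one_right {R : Type*} [CommSemiring R] (M : Multiset R) : M.esymm 1 = M.sum := by
  simp [Multiset.esymm, Multiset.powersetCard_one]

lemma esymm_eq_zero_of_card_lt {R : Type*} [CommSemiring R] {M : Multiset R} {j : ℕ}
    (h : M.card < j) : M.esymm j = 0 := by
  simp [Multiset.esymm, Multiset.powersetCard_eq_empty _ h]

/-! ### Real-rooted polynomials and Newton's inequality -/

open Polynomial in
lemma coeff_mul_coeff_le_of_prod (c : ℝ) (M : Multiset ℝ) :
    2 * ((C c * (M.map (fun r => X - C r)).prod).coeff 0 *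
      (C c * (M.map (fun r => X - C r)).prod).coeff 2) ≤
      (C c * (M.map (fun r => X - C r)).prod).coeff 1 ^ 2 := by
  induction M using Multiset.induction with
  | empty => simp [coeff_C]
  | cons r M ih =>
    rw [Multiset.map_cons, Multiset.prod_cons, mul_left_comm (C c)]
    generalize C c * (M.map (fun r => X - C r)).prod = p at ih ⊢
    have h0 : ((X - C r) * p).coeff 0 = - r * p.coeff 0 := by simp [sub_mul]
    have h1 : ((X - C r) * p).coeff 1 = p.coeff 0 - r * p.coeff 1 := by
      simp [sub_mul, coeff_X_mul p 0]
    have h2 : ((X - C r) * p).coeff 2 = p.coeff 1 - r * p.coeff 2 := by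
      simp [sub_mul, coeff_X_mul p 1]
    rw [h0, h1, h2]
    -- With `pᵢ` the coefficients of `p`, multiplication by `X - r` turns `p₁² - 2p₀p₂` into `p₀² +
    -- r²(p₁² - 2p₀p₂)`.
    nlinarith [sq_nonneg (p.coeff 0), mul_nonneg (sq_nonneg r) (sub_nonneg.2 ih)]

open Polynomial in
/-- Laguerre's inequality at the origin. -/
lemma coeff_mul_coeff_le_of_splits {p : ℝ[X]} (hp : p.Splits) :
    2 * (p.coeff 0 * p.coeff 2) ≤ p.coeff 1 ^ 2 := by
  have := coeff_mul_coeff_le_of_prod p.leadingCoeff p.roots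
  rwa [← hp.eq_prod_roots] at this

open Polynomial in
lemma splits_derivative {p : ℝ[X]} (hp : p.Splits) : (derivative p).Splits := by
  rw [splits_iff_card_roots] at hp ⊢
  refine le_antisymm (card_roots' _) ?_
  have h1 := card_roots_le_derivative p
  have h2 := natDegree_derivative_le p
  omega

open Polynomial in
lemma splits_iterate_derivative {p : ℝ[X]} (hp : p.Splits) (d : ℕ) :
    (derivative^[d] p).Splits := by
  induction d with
  | zero => exact hp
  | succ d ih => rw [Function.iterate_succ_apply']; exact splits_derivative ih

open Polynomial in
/-- **Newton's inequality** for elementary symmetric functions, without the sharp constant. -/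
lemma esymm_mul_esymm_le (M : Multiset ℝ) (j : ℕ) :
    M.esymm j * M.esymm (j + 2) ≤ M.esymm (j + 1) ^ 2 := by
  rcases lt_or_ge M.card (j + 2) with h | h
  · rw [esymm_eq_zero_of_card_lt h, mul_zero]; positivity
  obtain ⟨d, hd⟩ := Nat.exists_eq_add_of_le h
  set p : ℝ[X] := (M.map fun r => X + C r).prod with hp
  have hs : p.Splits := by
    rw [hp]
    refine Splits.multisetProd ?_
    intro f hf
    obtain ⟨r, -, rfl⟩ := Multiset.mem_map.1 hf
    exact Splits.X_add_C r
  have h0 : p.coeff d = M.esymm (j + 2) := by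
    rw [hp, Multiset.prod_X_add_C_coeff _ (by omega)]; congr 1; omega
  have h1 : p.coeff (d + 1) = M.esymm (j + 1) := by
    rw [hp, Multiset.prod_X_add_C_coeff _ (by omega)]; congr 1; omega
  have h2 : p.coeff (d + 2) = M.esymm j := by
    rw [hp, Multiset.prod_X_add_C_coeff _ (by omega)]; congr 1; omega
  -- Differentiating `d` times keeps the polynomial real-rooted and moves the three consecutive
  -- symmetric functions to the lowest coefficients.
  have key := coeff_mul_coeff_le_of_splits (splits_iterate_derivative hs d)
  simp only [coeff_iterate_derivative, nsmul_eq_mul, zero_add] at key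
  rw [add_comm 2 d, add_comm 1 d, h0, h1, h2, Nat.descFactorial_self] at key
  have e1 : (d + 1).descFactorial d = (d + 1).factorial := by
    have := Nat.factorial_mul_descFactorial (n := d + 1) (k := d) (by omega)
    simpa using this
  have e2 : 2 * (d + 2).descFactorial d = (d + 2).factorial := by
    have := Nat.factorial_mul_descFactorial (n := d + 2) (k := d) (by omega)
    simpa using this
  have e2' : (2 : ℝ) * ((d + 2).descFactorial d : ℝ) = ((d + 2).factorial : ℝ) := by
    exact_mod_cast e2
  rw [e1] at key
  have e3 : ((d + 2).factorial : ℝ) = (d + 2) * ((d + 1) * d.factorial) := by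
    push_cast [Nat.factorial_succ]; ring
  have e4 : ((d + 1).factorial : ℝ) = (d + 1) * d.factorial := by
    push_cast [Nat.factorial_succ]; ring
  have hpos : (0 : ℝ) < d.factorial := by exact_mod_cast d.factorial_pos
  set F : ℝ := (d.factorial : ℝ)
  set a := M.esymm j
  set b := M.esymm (j + 1)
  set c := M.esymm (j + 2)
  have key2 : (F ^ 2 * (d + 1)) * ((d + 2) * (a * c)) ≤ (F ^ 2 * (d + 1)) * ((d + 1) * b ^ 2) := by
    have : 2 * (F * c * (((d + 2).descFactorial d : ℝ) * a)) =
        (2 * ((d + 2).descFactorial d : ℝ)) * F * c * a := by ring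
    rw [this, e2', e3, e4] at key
    nlinarith [key]
  -- What remains is `(d+2)ac ≤ (d+1)b²`, which is stronger than `ac ≤ b²`.
  have key3 := le_of_mul_le_mul_left key2 (by positivity)
  by_contra hcon
  push Not at hcon
  have hd0 : (0 : ℝ) ≤ d := Nat.cast_nonneg d
  nlinarith [sq_nonneg b]

/-! ### Gårding cones and monotonicity of `S_k` -/

/-- All elementary symmetric functions up to order `k` are positive. -/
def IsGarding (k : ℕ) (M : Multiset ℝ) : Prop := ∀ j ≤ k, 0 < M.esymm j

/-- Induction on the order, with `eᵢ = M.esymm i`. If `e_j > 0 ≥ e_{j+1}`, then `e_{j+1} + a e_j >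
0` forces `a > 0`. Multiplying `e_{j+2} + a e_{j+1} > 0` by `e_j` and using Newton's inequality
gives `e_{j+1}(e_{j+1} + a e_j) > 0`, contradicting the signs of the factors. -/
lemma IsGarding.of_cons {k : ℕ} {a : ℝ} {M : Multiset ℝ} (h : IsGarding (k + 1) (a ::ₘ M)) :
    IsGarding k M := by
  intro j
  induction j with
  | zero => intro _; rw [esymm_zero_right]; exact one_pos
  | succ j ih =>
    intro hj
    have hj0 := ih (by omega)
    have h1 := h (j + 1) (by omega)
    have h2 := h (j + 1 + 1) (by omega)
    rw [esymm_cons] at h1 h2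
    have hN := esymm_mul_esymm_le M j
    by_contra hcon
    push Not at hcon
    have ha : 0 < a := by
      by_contra ha
      push Not at ha
      nlinarith
    nlinarith [mul_pos (show 0 < M.esymm (j + 1 + 1) + a * M.esymm (j + 1) from h2) hj0,
      mul_nonneg (neg_nonneg.2 hcon) h1.le]

lemma IsGarding.cons_mono {k : ℕ} {a b : ℝ} {M : Multiset ℝ} (h : IsGarding k (a ::ₘ M))
    (hab : a ≤ b) : ∀ j ≤ k, (a ::ₘ M).esymm j ≤ (b ::ₘ M).esymm j := by
  intro j hj
  rcases j with _ | j
  · rw [esymm_zero_right, esymm_zero_right]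
  · obtain ⟨k, rfl⟩ : ∃ l, k = l + 1 := ⟨k - 1, by omega⟩
    rw [esymm_cons, esymm_cons]
    have := h.of_cons j (by omega)
    gcongr

/-- The entries are raised one at a time and `L` stores those already raised; each raise increases
the symmetric functions, so the cone is never left. -/
lemma IsGarding.mono_add {k : ℕ} {M N : Multiset ℝ} (hMN : Multiset.Rel (· ≤ ·) M N) :
    ∀ L : Multiset ℝ, IsGarding k (M + L) → ∀ j ≤ k, (M + L).esymm j ≤ (N + L).esymm j := by
  induction hMN with
  | zero => intro L _ j _; exact le_rfl
  | @cons a b M N hab hMN ih =>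
    intro L h j hj
    have hc : ∀ c : ℝ, c ::ₘ M + L = c ::ₘ (M + L) := fun c => Multiset.cons_add _ _ _
    have h1 := IsGarding.cons_mono (hc a ▸ h) hab
    have h2 : IsGarding k (M + b ::ₘ L) := by
      intro i hi
      rw [Multiset.add_cons]
      exact lt_of_lt_of_le (hc a ▸ h i hi) (h1 i hi)
    have h3 := ih _ h2 j hj
    rw [Multiset.add_cons, Multiset.add_cons] at h3
    rw [hc, Multiset.cons_add]
    exact (h1 j hj).trans h3

/-- A positive sum has a positive entry, and removing it lowers the order of the cone by only one.
-/
lemma IsGarding.le_card_filter_pos {k : ℕ} {M : Multiset ℝ} (h : IsGarding k M) :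
    k ≤ (M.filter fun a => 0 < a).card := by
  induction k generalizing M with
  | zero => exact Nat.zero_le _
  | succ k ih =>
    have h1 := h 1 (by omega)
    rw [esymm_one_right] at h1
    obtain ⟨a, ha, hpos⟩ : ∃ a ∈ M, 0 < a := by
      by_contra hcon
      push Not at hcon
      exact absurd h1 (not_lt.2 (by simpa using Multiset.sum_le_card_nsmul M 0 hcon))
    obtain ⟨M', rfl⟩ := Multiset.exists_cons_of_mem ha
    have := ih h.of_cons
    rw [Multiset.filter_cons_of_pos (p := fun a => 0 < a) _ hpos, Multiset.card_cons]
    omega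

lemma sigma_eq_esymm {n : ℕ} (k : ℕ) (v : Fin n → ℝ) :
    sigma k v = ((Finset.univ : Finset (Fin n)).val.map v).esymm k :=
  (Finset.esymm_map_val v Finset.univ k).symm

lemma sigma_eq_zero {n k : ℕ} (h : n < k) (v : Fin n → ℝ) : sigma k v = 0 := by
  rw [sigma_eq_esymm, esymm_eq_zero_of_card_lt (by simpa using h)]

lemma S_mono_of_nonneg {n : ℕ} (k : ℕ) {v w : Fin n → ℝ} (hv : 0 ≤ v) (hvw : v ≤ w) :
    S k v ≤ S k w := by
  unfold S sigma
  exact add_le_add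
    (Finset.sum_le_sum fun s _ => Finset.prod_le_prod (fun i _ => hv i) fun i _ => hvw i)
    (Finset.sum_le_sum fun s _ => Finset.prod_le_prod (fun i _ => hv i) fun i _ => hvw i)

lemma S_eq_esymm_cons {n k : ℕ} (hk : 1 ≤ k) (v : Fin n → ℝ) :
    S k v = (1 ::ₘ (Finset.univ : Finset (Fin n)).val.map v).esymm k := by
  obtain ⟨k, rfl⟩ : ∃ l, k = l + 1 := ⟨k - 1, by omega⟩
  rw [esymm_cons, S, sigma_eq_esymm, sigma_eq_esymm, one_mul, Nat.add_sub_cancel]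

/-- The sum operator `S_k` is monotone in each variable, starting from an admissible vector. -/
lemma S_mono_of_mem_GamTilde {n k : ℕ} (hk : 1 ≤ k) {v w : Fin n → ℝ} (hv : v ∈ GamTilde n k)
    (hvw : v ≤ w) : S k v ≤ S k w := by
  rw [S_eq_esymm_cons hk, S_eq_esymm_cons hk]
  set M := (Finset.univ : Finset (Fin n)).val.map v with hM
  set N := (Finset.univ : Finset (Fin n)).val.map w
  have hrel : Multiset.Rel (· ≤ ·) M N :=
    Multiset.rel_map.2 (Multiset.rel_refl_of_refl_on fun i _ => hvw i)
  have hsig : ∀ j ≤ k - 1, 0 < M.esymm j := by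
    intro j hj
    rcases Nat.eq_zero_or_pos j with rfl | h
    · rw [esymm_zero_right]; exact one_pos
    · rw [hM, ← sigma_eq_esymm]; exact hv.1 j h hj
  -- The symmetric functions of `(1, v)` are `σ_j + σ_{j-1}`: positive for `j < k` by `Γ_{k-1}`, and
  -- for `j = k` by `S_k > 0`.
  have hG : IsGarding k (M + {1}) := by
    intro j hj
    rw [add_comm, Multiset.singleton_add]
    rcases hj.lt_or_eq with h | rfl
    · rcases j with _ | j
      · rw [esymm_zero_right]; exact one_pos
      · rw [esymm_cons, one_mul]
        exact add_pos (hsig _ (by omega)) (hsig _ (by omega))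
    · rw [← S_eq_esymm_cons hk]; exact hv.2
  have := IsGarding.mono_add hrel _ hG k le_rfl
  rwa [add_comm, Multiset.singleton_add, add_comm, Multiset.singleton_add] at this

lemma le_card_pos_of_mem_GamTilde {n k : ℕ} {v : Fin n → ℝ} (hv : v ∈ GamTilde n k) :
    k - 1 ≤ (Finset.univ.filter fun i => 0 < v i).card := by
  have hG : IsGarding (k - 1) ((Finset.univ : Finset (Fin n)).val.map v) := by
    intro j hj
    rcases Nat.eq_zero_or_pos j with rfl | h
    · rw [esymm_zero_right]; exact one_pos
    · rw [← sigma_eq_esymm]; exact hv.1 j h hj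
  have := hG.le_card_filter_pos
  rwa [Multiset.filter_map, Multiset.card_map] at this

/-! ### Quadratic forms and eigenvalues -/

lemma dotProduct_mulVec_eq_sum_eigenvalues {n : ℕ} {A : Matrix (Fin n) (Fin n) ℝ}
    (hA : A.IsHermitian) (v : Fin n → ℝ) :
    v ⬝ᵥ A *ᵥ v = ∑ i, hA.eigenvalues i * ((hA.eigenvectorBasis i).ofLp ⬝ᵥ v) ^ 2 := by
  have h := hA.eigenvectorBasis.sum_inner_mul_inner (WithLp.toLp 2 v) (WithLp.toLp 2 (A *ᵥ v))
  simp only [EuclideanSpace.inner_eq_star_dotProduct, star_trivial] at h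
  rw [dotProduct_comm, ← h]
  refine Finset.sum_congr rfl fun i _ => ?_
  have hT : Aᵀ = A := (by simpa using hA : A.IsSymm).eq
  have : A *ᵥ v ⬝ᵥ (hA.eigenvectorBasis i).ofLp =
      hA.eigenvalues i * ((hA.eigenvectorBasis i).ofLp ⬝ᵥ v) := by
    rw [dotProduct_comm, dotProduct_mulVec, ← mulVec_transpose, hT, hA.mulVec_eigenvectorBasis,
      smul_dotProduct, smul_eq_mul]
  rw [this]; ring

lemma dotProduct_self_eq_sum_eigenvectorBasis {n : ℕ} {A : Matrix (Fin n) (Fin n) ℝ}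
    (hA : A.IsHermitian) (v : Fin n → ℝ) :
    v ⬝ᵥ v = ∑ i, ((hA.eigenvectorBasis i).ofLp ⬝ᵥ v) ^ 2 := by
  have h := hA.eigenvectorBasis.sum_inner_mul_inner (WithLp.toLp 2 v) (WithLp.toLp 2 v)
  simp only [EuclideanSpace.inner_eq_star_dotProduct, star_trivial] at h
  rw [← h]
  refine Finset.sum_congr rfl fun i _ => ?_
  rw [dotProduct_comm v, sq]

lemma exists_ne_zero_dotProduct_eq_zero {n : ℕ} {ι : Type*} [Fintype ι]
    (h : Fintype.card ι < n) (c : ι → Fin n → ℝ) :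
    ∃ v : Fin n → ℝ, v ≠ 0 ∧ ∀ i, c i ⬝ᵥ v = 0 := by
  have hker : LinearMap.ker (Matrix.of c).mulVecLin ≠ ⊥ :=
    LinearMap.ker_ne_bot_of_finrank_lt (by simpa using h)
  obtain ⟨v, hv, hv0⟩ := (Submodule.ne_bot_iff _).1 hker
  exact ⟨v, hv0, fun i => congrFun (LinearMap.mem_ker.1 hv) i⟩

/-- **Weyl's monotonicity principle**: eigenvalues are monotone in the quadratic form. -/
lemma eigenvalues_le_eigenvalues {n : ℕ} {A B : Matrix (Fin n) (Fin n) ℝ}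
    (hA : A.IsHermitian) (hB : B.IsHermitian)
    (h : ∀ v : Fin n → ℝ, v ⬝ᵥ A *ᵥ v ≤ v ⬝ᵥ B *ᵥ v) (j : Fin n) :
    hA.eigenvalues j ≤ hB.eigenvalues j := by
  by_contra! hlt
  -- Position in the decreasing order of the eigenvalues.
  let e := (Fintype.equivOfCardEq (Fintype.card_fin (Fintype.card (Fin n))) :
    Fin (Fintype.card (Fin n)) ≃ Fin n).symm
  have hanti : ∀ {C : Matrix (Fin n) (Fin n) ℝ} (hC : C.IsHermitian) {i l : Fin n},
      e i ≤ e l → hC.eigenvalues l ≤ hC.eigenvalues i :=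
    fun hC i l hil => hC.eigenvalues₀_antitone hil
  -- These are `n - 1` conditions: `v` is orthogonal to the eigenvectors of `A` after position `j`
  -- and to those of `B` before it. Its Rayleigh quotient is then at least the `j`-th eigenvalue for
  -- `A` and at most that for `B`.
  obtain ⟨v, hv0, hv⟩ := exists_ne_zero_dotProduct_eq_zero (n := n) (ι := {i : Fin n // i ≠ j})
    (by
      rw [Fintype.card_subtype_compl, Fintype.card_fin, Fintype.card_subtype_eq]
      have := j.pos
      omega)
    (fun i => if e j < e i then (hA.eigenvectorBasis i).ofLp else (hB.eigenvectorBasis i).ofLp)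
  have h1 : hA.eigenvalues j * (v ⬝ᵥ v) ≤ v ⬝ᵥ A *ᵥ v := by
    rw [dotProduct_mulVec_eq_sum_eigenvalues hA, dotProduct_self_eq_sum_eigenvectorBasis hA,
      Finset.mul_sum]
    refine Finset.sum_le_sum fun i _ => ?_
    rcases lt_or_ge (e j) (e i) with hi | hi
    · have := hv ⟨i, fun hij => by simp [hij] at hi⟩
      rw [if_pos hi] at this
      simp [this]
    · exact mul_le_mul_of_nonneg_right (hanti hA hi) (sq_nonneg _)
  have h2 : v ⬝ᵥ B *ᵥ v ≤ hB.eigenvalues j * (v ⬝ᵥ v) := by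
    rw [dotProduct_mulVec_eq_sum_eigenvalues hB, dotProduct_self_eq_sum_eigenvectorBasis hB,
      Finset.mul_sum]
    refine Finset.sum_le_sum fun i _ => ?_
    rcases lt_or_ge (e i) (e j) with hi | hi
    · have := hv ⟨i, fun hij => by simp [hij] at hi⟩
      rw [if_neg (not_lt.2 hi.le)] at this
      simp [this]
    · exact mul_le_mul_of_nonneg_right (hanti hB hi) (sq_nonneg _)
  have hpos : 0 < v ⬝ᵥ v :=
    lt_of_le_of_ne (Finset.sum_nonneg fun i _ => mul_self_nonneg _)
      (Ne.symm (mt dotProduct_self_eq_zero.1 hv0))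
  have := mul_lt_mul_of_pos_right hlt hpos
  linarith [h v]

/-- A quadratic form that is nonpositive on the coordinate subspace spanned by `T` has at most
`n - |T|` positive eigenvalues. -/
lemma card_pos_eigenvalues_add_card_le {n : ℕ} {A : Matrix (Fin n) (Fin n) ℝ}
    (hA : A.IsHermitian) (T : Finset (Fin n))
    (h : ∀ v : Fin n → ℝ, (∀ i ∉ T, v i = 0) → v ⬝ᵥ A *ᵥ v ≤ 0) :
    (Finset.univ.filter fun i => 0 < hA.eigenvalues i).card + T.card ≤ n := by
  by_contra! hlt
  obtain ⟨v, hv0, hv⟩ := exists_ne_zero_dotProduct_eq_zero (n := n)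
    (ι := {i : Fin n // i ∉ T} ⊕ {i : Fin n // ¬ 0 < hA.eigenvalues i})
    (by
      have h1 : T.card ≤ n := by simpa using T.card_le_univ
      have h2 : (Finset.univ.filter fun i => 0 < hA.eigenvalues i).card ≤ n := by
        simpa using (Finset.univ.filter fun i => 0 < hA.eigenvalues i).card_le_univ
      rw [Fintype.card_sum, Fintype.card_subtype_compl, Fintype.card_subtype_compl,
        Fintype.card_fin, Fintype.card_coe, Fintype.card_subtype]
      omega)
    (Sum.elim (fun i => Pi.single i.1 1) fun i => (hA.eigenvectorBasis i.1).ofLp)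
  have hT : ∀ i ∉ T, v i = 0 := fun i hi => by simpa using hv (Sum.inl ⟨i, hi⟩)
  have hneg : ∀ i, ¬ 0 < hA.eigenvalues i → (hA.eigenvectorBasis i).ofLp ⬝ᵥ v = 0 :=
    fun i hi => by simpa using hv (Sum.inr ⟨i, hi⟩)
  have hle := h v hT
  have hnn : ∀ i ∈ Finset.univ,
      0 ≤ hA.eigenvalues i * ((hA.eigenvectorBasis i).ofLp ⬝ᵥ v) ^ 2 := by
    intro i _
    by_cases hi : 0 < hA.eigenvalues i
    · positivity
    · simp [hneg i hi]
  rw [dotProduct_mulVec_eq_sum_eigenvalues hA] at hle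
  have hz := (Finset.sum_eq_zero_iff_of_nonneg hnn).1 (le_antisymm hle (Finset.sum_nonneg hnn))
  refine hv0 (dotProduct_self_eq_zero.1 ?_)
  rw [dotProduct_self_eq_sum_eigenvectorBasis hA]
  refine Finset.sum_eq_zero fun i _ => ?_
  by_cases hi : 0 < hA.eigenvalues i
  · exact (mul_eq_zero.1 (hz i (Finset.mem_univ i))).resolve_left hi.ne'
  · simp [hneg i hi]

lemma eigs_eq {n : ℕ} {A : Matrix (Fin n) (Fin n) ℝ} (hA : A.IsHermitian) :
    eigs A = hA.eigenvalues := dif_pos hA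

lemma eigs_mono {n : ℕ} {A B : Matrix (Fin n) (Fin n) ℝ}
    (hA : A.IsHermitian) (hB : B.IsHermitian)
    (h : ∀ v : Fin n → ℝ, v ⬝ᵥ A *ᵥ v ≤ v ⬝ᵥ B *ᵥ v) : eigs A ≤ eigs B := by
  rw [eigs_eq hA, eigs_eq hB]
  exact fun j => eigenvalues_le_eigenvalues hA hB h j

lemma eigs_nonneg {n : ℕ} {A : Matrix (Fin n) (Fin n) ℝ} (hA : A.IsHermitian)
    (h : ∀ v : Fin n → ℝ, 0 ≤ v ⬝ᵥ A *ᵥ v) : 0 ≤ eigs A := by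
  have hps : A.PosSemidef := Matrix.PosSemidef.of_dotProduct_mulVec_nonneg hA (by simpa using h)
  rw [eigs_eq hA]
  exact fun j => hps.eigenvalues_nonneg j

/-! ### Principal minors and the block determinant -/

/-- `σ_j` of the eigenvalues is the sum of the principal minors of order `j`. -/
lemma sigma_eigs_eq_sum_minors {n : ℕ} {A : Matrix (Fin n) (Fin n) ℝ} (hA : A.IsHermitian)
    {j : ℕ} (hj : j ≤ n) :
    sigma j (eigs A) = ∑ s ∈ Finset.powersetCard j (Finset.univ : Finset (Fin n)),
      (A.submatrix (Subtype.val : s → Fin n) (Subtype.val : s → Fin n)).det := by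
  have h := Matrix.charpoly_coeff_eq_sum_minors A j (by simpa using hj)
  rw [Polynomial.coeff_eq_esymm_roots_of_card
    (by rw [hA.roots_charpoly_eq_eigenvalues, A.charpoly_natDegree_eq_dim]; simp)
    (by rw [A.charpoly_natDegree_eq_dim]; omega), hA.roots_charpoly_eq_eigenvalues,
    A.charpoly_monic.leadingCoeff, A.charpoly_natDegree_eq_dim, Fintype.card_fin,
    Nat.sub_sub_self hj, one_mul] at h
  rw [sigma_eq_esymm, eigs_eq hA]
  exact mul_left_cancel₀ (pow_ne_zero j (by norm_num)) h

/-- If the entries of `A` outside of the block `K × K` vanish and `|K| = k - 1`, then `S_k` of the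
eigenvalues is the determinant of the block. -/
lemma S_eigs_eq_det {n k : ℕ} (hk : 1 ≤ k) {A : Matrix (Fin n) (Fin n) ℝ} (hA : A.IsHermitian)
    (K : Finset (Fin n)) (hK : K.card = k - 1) (h : ∀ i ∉ K, ∀ j, A i j = 0) :
    S k (eigs A) =
      (A.submatrix (Subtype.val : K → Fin n) (Subtype.val : K → Fin n)).det := by
  have hKn : K.card ≤ n := by simpa using K.card_le_univ
  have hz : ∀ s : Finset (Fin n), ¬ s ⊆ K →
      (A.submatrix (Subtype.val : s → Fin n) (Subtype.val : s → Fin n)).det = 0 := by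
    intro s hs
    obtain ⟨i, his, hiK⟩ := Finset.not_subset.1 hs
    exact Matrix.det_eq_zero_of_row_eq_zero ⟨i, his⟩ fun j => h i hiK j
  have h1 : sigma k (eigs A) = 0 := by
    rcases lt_or_ge n k with hlt | hle
    · exact sigma_eq_zero hlt _
    · rw [sigma_eigs_eq_sum_minors hA hle]
      refine Finset.sum_eq_zero fun s hs => hz s fun hsK => ?_
      have := Finset.card_le_card hsK
      rw [(Finset.mem_powersetCard.1 hs).2] at this
      omega
  have h2 : sigma (k - 1) (eigs A) =
      (A.submatrix (Subtype.val : K → Fin n) (Subtype.val : K → Fin n)).det := by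
    rw [sigma_eigs_eq_sum_minors hA (hK ▸ hKn)]
    refine Finset.sum_eq_single_of_mem K (Finset.mem_powersetCard.2 ⟨K.subset_univ, hK⟩) ?_
    intro s hs hsK
    refine hz s fun hsub => hsK (Finset.eq_of_subset_of_card_le hsub ?_)
    rw [hK, (Finset.mem_powersetCard.1 hs).2]
  rw [S, h1, h2, zero_add]

/-- The determinant of a diagonal matrix with a rank two perturbation. -/
lemma det_diagonal_add_rank_two {ι : Type*} [Fintype ι] [DecidableEq ι] (i₀ : ι) (w : ι → ℝ)
    (hw : w i₀ = 0) {a c : ℝ} (b d : ℝ) (ha : a ≠ 0) (hc : c ≠ 0) :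
    (Matrix.of fun i j => (if i = j then (if i = i₀ then a else c) else 0) +
      b * ((if i = i₀ then 1 else 0) * w j + w i * (if j = i₀ then 1 else 0)) +
      d * (w i * w j)).det =
      a * c ^ (Fintype.card ι - 1) * (1 + (d / c - b ^ 2 / (a * c)) * ∑ i, w i ^ 2) := by
  set D : ι → ℝ := fun i => if i = i₀ then a else c with hD
  have hD0 : ∀ i, D i ≠ 0 := by
    intro i; rw [hD]; dsimp only; split_ifs <;> assumption
  set e : ι → ℝ := fun i => if i = i₀ then 1 else 0 with he
  let U : Matrix ι (Fin 2) ℝ := Matrix.of fun i => ![e i / a, w i / c]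
  let V : Matrix (Fin 2) ι ℝ := Matrix.of ![fun j => b * w j, fun j => b * e j + d * w j]
  -- Factoring out the diagonal leaves the identity plus a product through dimension two, so `det (1
  -- + UV) = det (1 + VU)` reduces to a `2 × 2` determinant. Since `w i₀ = 0`, the diagonal acts on
  -- `w` as the scalar `c`.
  have hfac : (Matrix.of fun i j => (if i = j then (if i = i₀ then a else c) else 0) +
      b * (e i * w j + w i * e j) + d * (w i * w j)) = Matrix.diagonal D * (1 + U * V) := by
    ext i j
    have h1 : D i * (e i / a) = e i := by
      simp only [hD, he]; split_ifs <;> field_simp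
      simp
    have h2 : D i * (w i / c) = w i := by
      simp only [hD]
      split_ifs with h
      · simp [h, hw]
      · field_simp
    rw [Matrix.diagonal_mul, Matrix.add_apply, Matrix.mul_apply, Fin.sum_univ_two, Matrix.one_apply]
    simp only [U, V, Matrix.of_apply, Matrix.cons_val_zero, Matrix.cons_val_one]
    have h3 : (if i = j then (if i = i₀ then a else c) else 0) = D i * (if i = j then 1 else 0) := by
      simp [hD]
    rw [h3]
    linear_combination (-(b * w j)) * h1 - (b * e j + d * w j) * h2
  rw [hfac, Matrix.det_mul, Matrix.det_diagonal, Matrix.det_one_add_mul_comm]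
  have hdet : ∏ i, D i = a * c ^ (Fintype.card ι - 1) := by
    rw [← Finset.mul_prod_erase _ _ (Finset.mem_univ i₀),
      Finset.prod_congr rfl (g := fun _ => c)
        (fun i hi => by simp [hD, Finset.ne_of_mem_erase hi])]
    simp [hD, Finset.card_erase_of_mem, Finset.card_univ]
  have hewz : ∑ i, e i * w i = 0 := by simp [he, hw]
  have hee : ∑ i, e i * e i = 1 := by simp [he]
  have h00 : (V * U) 0 0 = 0 := by
    rw [Matrix.mul_apply]
    simp only [U, V, Matrix.of_apply, Matrix.cons_val_zero]
    rw [show (0 : ℝ) = b / a * ∑ i, e i * w i by rw [hewz, mul_zero], Finset.mul_sum]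
    exact Finset.sum_congr rfl fun i _ => by ring
  have h01 : (V * U) 0 1 = b / c * ∑ i, w i ^ 2 := by
    rw [Matrix.mul_apply, Finset.mul_sum]
    simp only [U, V, Matrix.of_apply, Matrix.cons_val_zero, Matrix.cons_val_one]
    exact Finset.sum_congr rfl fun i _ => by ring
  have h10 : (V * U) 1 0 = b / a := by
    rw [Matrix.mul_apply]
    simp only [U, V, Matrix.of_apply, Matrix.cons_val_zero, Matrix.cons_val_one]
    rw [show b / a = b / a * ∑ i, e i * e i + d / a * ∑ i, e i * w i by
      rw [hewz, hee, mul_zero, mul_one, add_zero], Finset.mul_sum, Finset.mul_sum,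
      ← Finset.sum_add_distrib]
    exact Finset.sum_congr rfl fun i _ => by ring
  have h11 : (V * U) 1 1 = d / c * ∑ i, w i ^ 2 := by
    rw [Matrix.mul_apply]
    simp only [U, V, Matrix.of_apply, Matrix.cons_val_zero, Matrix.cons_val_one]
    rw [show d / c * ∑ i, w i ^ 2 = b / c * ∑ i, e i * w i + d / c * ∑ i, w i ^ 2 by
      rw [hewz, mul_zero, zero_add], Finset.mul_sum, Finset.mul_sum,
      ← Finset.sum_add_distrib]
    exact Finset.sum_congr rfl fun i _ => by ring
  rw [hdet, Matrix.det_fin_two]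
  simp only [Matrix.add_apply, h00, h01, h10, h11, Matrix.one_apply_eq, ne_eq, zero_ne_one,
    one_ne_zero, not_false_eq_true, Matrix.one_apply_ne]
  field_simp
  ring

/-! ### Second-order conditions at touching points -/

/-- A second order necessary condition for a local maximum. -/
lemma second_deriv_nonpos_of_isLocalMax {h h₁ : ℝ → ℝ} {c : ℝ}
    (h0 : ∀ᶠ t in nhds 0, HasDerivAt h (h₁ t) t) (h1 : HasDerivAt h₁ c 0)
    (hmax : IsLocalMax h 0) : c ≤ 0 := by
  by_contra! hc
  have hd : deriv h =ᶠ[nhds 0] h₁ := h0.mono fun t ht => ht.deriv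
  have hdd : deriv (deriv h) 0 = c := by rw [hd.deriv_eq, h1.deriv]
  -- If `c > 0`, the maximum is also a minimum, so `h` is locally constant and `c = 0`.
  have hmin : IsLocalMin h 0 :=
    isLocalMin_of_deriv_deriv_pos (by rw [hdd]; exact hc) hmax.deriv_eq_zero
      h0.self_of_nhds.continuousAt
  have hconst : h =ᶠ[nhds 0] fun _ => h 0 := by
    filter_upwards [hmin, hmax] with t h1 h2 using le_antisymm h2 h1
  have hd0 : deriv h =ᶠ[nhds 0] fun _ => 0 := by
    filter_upwards [hconst.eventuallyEq_nhds] with t ht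
    rw [ht.deriv_eq, deriv_const]
  rw [hd0.deriv_eq, deriv_const] at hdd
  exact hc.ne hdd

lemma hess_isHermitian {n : ℕ} {φ : EuclideanSpace ℝ (Fin n) → ℝ} {x : EuclideanSpace ℝ (Fin n)}
    (hφ : ContDiffAt ℝ 2 φ x) : (hess φ x).IsHermitian := by
  ext i j
  simpa [hess] using hφ.isSymmSndFDerivAt (by simp) (EuclideanSpace.single j 1)
    (EuclideanSpace.single i 1)

lemma dotProduct_hess_mulVec {n : ℕ} (φ : EuclideanSpace ℝ (Fin n) → ℝ)
    (x : EuclideanSpace ℝ (Fin n)) (v : Fin n → ℝ) :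
    v ⬝ᵥ hess φ x *ᵥ v = fderiv ℝ (fderiv ℝ φ) x (WithLp.toLp 2 v) (WithLp.toLp 2 v) := by
  have hv : WithLp.toLp 2 v = ∑ i, v i • EuclideanSpace.single i (1 : ℝ) := by
    ext j; simp [Pi.single_apply]
  rw [hv]
  simp only [map_sum, map_smul, _root_.sum_apply, _root_.smul_apply,
    dotProduct, mulVec, hess, Matrix.of_apply, smul_eq_mul]
  simp only [Finset.mul_sum]
  rw [Finset.sum_comm]
  exact Finset.sum_congr rfl fun i _ => Finset.sum_congr rfl fun j _ => by ring

lemma hasDerivAt_line {n : ℕ} (x v : EuclideanSpace ℝ (Fin n)) (t : ℝ) :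
    HasDerivAt (fun t : ℝ => x + t • v) v t := by
  simpa using ((hasDerivAt_id t).smul_const v).const_add x

lemma tendsto_line {n : ℕ} (x v : EuclideanSpace ℝ (Fin n)) :
    Filter.Tendsto (fun t : ℝ => x + t • v) (nhds 0) (nhds x) := by
  have := (hasDerivAt_line x v 0).continuousAt.tendsto
  simpa using this

lemma eventually_hasDerivAt_line {n : ℕ} {φ : EuclideanSpace ℝ (Fin n) → ℝ}
    {x : EuclideanSpace ℝ (Fin n)} (hφ : ContDiffAt ℝ 2 φ x) (v : EuclideanSpace ℝ (Fin n)) :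
    ∀ᶠ t : ℝ in nhds 0, HasDerivAt (fun t : ℝ => φ (x + t • v)) (fderiv ℝ φ (x + t • v) v) t := by
  have h1 : ∀ᶠ y in nhds x, DifferentiableAt ℝ φ y :=
    (hφ.eventually (by simp)).mono fun y hy => hy.differentiableAt (by simp)
  filter_upwards [(tendsto_line x v).eventually h1] with t ht
  exact ht.hasFDerivAt.comp_hasDerivAt t (hasDerivAt_line x v t)

lemma hasDerivAt_fderiv_line {n : ℕ} {φ : EuclideanSpace ℝ (Fin n) → ℝ}
    {x : EuclideanSpace ℝ (Fin n)} (hφ : ContDiffAt ℝ 2 φ x) (v : Fin n → ℝ) :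
    HasDerivAt (fun t : ℝ => fderiv ℝ φ (x + t • WithLp.toLp 2 v) (WithLp.toLp 2 v))
      (v ⬝ᵥ hess φ x *ᵥ v) 0 := by
  rw [dotProduct_hess_mulVec]
  have h1 : DifferentiableAt ℝ (fderiv ℝ φ) x :=
    (hφ.fderiv_right (m := 1) (by norm_num)).differentiableAt (by simp)
  have h2 : HasFDerivAt (fderiv ℝ φ) (fderiv ℝ (fderiv ℝ φ) x) (x + (0 : ℝ) • WithLp.toLp 2 v) := by
    simpa using h1.hasFDerivAt
  exact (ContinuousLinearMap.apply ℝ ℝ (WithLp.toLp 2 v)).hasFDerivAt.comp_hasDerivAt 0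
    (h2.comp_hasDerivAt 0 (hasDerivAt_line x _ 0))

/-- If `u - φ` has a local maximum at `x`, then the second derivatives of `u` along lines through
`x` are bounded above by the Hessian form of `φ`. -/
lemma le_hess_of_isLocalMax {n : ℕ} {φ u : EuclideanSpace ℝ (Fin n) → ℝ}
    {x : EuclideanSpace ℝ (Fin n)} (hφ : ContDiffAt ℝ 2 φ x) {v : Fin n → ℝ} {g g₁ : ℝ → ℝ} {c : ℝ}
    (h0 : ∀ᶠ t in nhds 0, HasDerivAt g (g₁ t) t) (h1 : HasDerivAt g₁ c 0)
    (hg : ∀ᶠ t in nhds 0, g t ≤ u (x + t • WithLp.toLp 2 v)) (hg0 : g 0 = u x)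
    (hmax : IsLocalMax (fun y => u y - φ y) x) : c ≤ v ⬝ᵥ hess φ x *ᵥ v := by
  refine sub_nonpos.1 (second_deriv_nonpos_of_isLocalMax
    (h := fun t => g t - φ (x + t • WithLp.toLp 2 v)) ?_
    (h1.sub (hasDerivAt_fderiv_line hφ v)) ?_)
  · filter_upwards [h0, eventually_hasDerivAt_line hφ (WithLp.toLp 2 v)] with t ht1 ht2
    exact ht1.sub ht2
  · filter_upwards [hg, (tendsto_line x (WithLp.toLp 2 v)).eventually hmax] with t ht1 ht2
    simp only [zero_smul, add_zero, hg0]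
    linarith

/-- If `u - φ` has a local minimum at `x`, then the second derivatives of `u` along lines through
`x` are bounded below by the Hessian form of `φ`. -/
lemma hess_le_of_isLocalMin {n : ℕ} {φ u : EuclideanSpace ℝ (Fin n) → ℝ}
    {x : EuclideanSpace ℝ (Fin n)} (hφ : ContDiffAt ℝ 2 φ x) {v : Fin n → ℝ} {g₁ : ℝ → ℝ} {c : ℝ}
    (h0 : ∀ᶠ t in nhds 0, HasDerivAt (fun t : ℝ => u (x + t • WithLp.toLp 2 v)) (g₁ t) t)
    (h1 : HasDerivAt g₁ c 0)
    (hmin : IsLocalMin (fun y => u y - φ y) x) : v ⬝ᵥ hess φ x *ᵥ v ≤ c := by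
  refine sub_nonpos.1 (second_deriv_nonpos_of_isLocalMax
    (h := fun t => φ (x + t • WithLp.toLp 2 v) - u (x + t • WithLp.toLp 2 v)) ?_
    ((hasDerivAt_fderiv_line hφ v).sub h1) ?_)
  · filter_upwards [h0, eventually_hasDerivAt_line hφ (WithLp.toLp 2 v)] with t ht1 ht2
    exact ht2.sub ht1
  · filter_upwards [(tendsto_line x (WithLp.toLp 2 v)).eventually hmin] with t ht
    simp only [zero_smul, add_zero]
    linarith

/-! ### One-dimensional calculus of `(1 + x₁²)|x'|^{2q}` -/

/-- The restriction of `pogorelov` to a line. -/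
def profile (q p p' β₀ β₁ β₂ t : ℝ) : ℝ :=
  (1 + (p + t * p') ^ 2) * (β₀ + 2 * β₁ * t + β₂ * t ^ 2) ^ q

/-- The first derivative of `profile`. -/
def profile₁ (q p p' β₀ β₁ β₂ t : ℝ) : ℝ :=
  2 * (p + t * p') * p' * (β₀ + 2 * β₁ * t + β₂ * t ^ 2) ^ q +
    (1 + (p + t * p') ^ 2) *
      ((2 * β₁ + 2 * β₂ * t) * q * (β₀ + 2 * β₁ * t + β₂ * t ^ 2) ^ (q - 1))

/-- The Hessian form of `pogorelov`, where `p`, `β₀` are the values of `x₁`, `|x'|²` at the point,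
and `p'`, `β₁`, `β₂` those of `v₁`, `x' ⬝ v'`, `|v'|²`. -/
def hessForm (q p p' β₀ β₁ β₂ : ℝ) : ℝ :=
  2 * β₀ ^ q * p' ^ 2 + 2 * (4 * p * q * β₀ ^ (q - 1)) * p' * β₁ +
    2 * (1 + p ^ 2) * q * β₀ ^ (q - 1) * β₂ +
    4 * (1 + p ^ 2) * q * (q - 1) * β₀ ^ (q - 2) * β₁ ^ 2

lemma hasDerivAt_quadratic (β₀ β₁ β₂ t : ℝ) :
    HasDerivAt (fun t => β₀ + 2 * β₁ * t + β₂ * t ^ 2) (2 * β₁ + 2 * β₂ * t) t := by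
  have h := (((hasDerivAt_id t).const_mul (2 * β₁)).const_add β₀).add
    ((hasDerivAt_pow 2 t).const_mul β₂)
  refine h.congr_deriv ?_
  simp; ring

lemma hasDerivAt_profile (q p p' β₀ β₁ β₂ : ℝ) {t : ℝ} (ht : 0 < β₀ + 2 * β₁ * t + β₂ * t ^ 2) :
    HasDerivAt (profile q p p' β₀ β₁ β₂) (profile₁ q p p' β₀ β₁ β₂ t) t := by
  have h1 : HasDerivAt (fun t => 1 + (p + t * p') ^ 2) (2 * (p + t * p') * p') t := by
    have := ((((hasDerivAt_id t).mul_const p').const_add p).pow 2).const_add 1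
    refine this.congr_deriv ?_
    simp
  exact h1.mul ((hasDerivAt_quadratic β₀ β₁ β₂ t).rpow_const (Or.inl ht.ne'))

lemma hasDerivAt_profile₁ (q p p' β₀ β₁ β₂ : ℝ) {t : ℝ} (ht : 0 < β₀ + 2 * β₁ * t + β₂ * t ^ 2) :
    HasDerivAt (profile₁ q p p' β₀ β₁ β₂)
      (hessForm q (p + t * p') p' (β₀ + 2 * β₁ * t + β₂ * t ^ 2) (β₁ + β₂ * t) β₂) t := by
  have h0 : HasDerivAt (fun t => p + t * p') p' t := by
    simpa using ((hasDerivAt_id t).mul_const p').const_add p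
  have h1 : HasDerivAt (fun t => 1 + (p + t * p') ^ 2) (2 * (p + t * p') * p') t := by
    refine ((h0.pow 2).const_add 1).congr_deriv ?_
    simp
  have h2 : HasDerivAt (fun t => 2 * (p + t * p') * p') (2 * p' * p') t :=
    (h0.const_mul 2).mul_const p'
  have hB := hasDerivAt_quadratic β₀ β₁ β₂ t
  have h3 : HasDerivAt (fun t => (2 * β₁ + 2 * β₂ * t) * q) (2 * β₂ * q) t := by
    simpa using (((hasDerivAt_id t).const_mul (2 * β₂)).const_add (2 * β₁)).mul_const q
  have h := (h2.mul (hB.rpow_const (p := q) (Or.inl ht.ne'))).add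
    (h1.mul (h3.mul (hB.rpow_const (p := q - 1) (Or.inl ht.ne'))))
  refine h.congr_deriv ?_
  simp only [Pi.mul_apply]
  rw [hessForm, show q - 1 - 1 = q - 2 by ring]
  ring

lemma rpow_eq_rpow_sub_two_mul {s : ℝ} (hs : 0 < s) (q : ℝ) :
    s ^ q = s ^ (q - 2) * s ^ 2 ∧ s ^ (q - 1) = s ^ (q - 2) * s := by
  constructor
  · rw [← Real.rpow_natCast s 2, ← Real.rpow_add hs]; norm_num
  · nth_rewrite 3 [← Real.rpow_one s]
    rw [← Real.rpow_add hs]; ring_nf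

lemma hessForm_nonneg {q p p' β₀ β₁ β₂ : ℝ} (hq : 2 / 3 ≤ q) (hq1 : q < 1) (hp : p ^ 2 ≤ 1 / 9)
    (hβ₀ : 0 < β₀) (hβ : β₁ ^ 2 ≤ β₀ * β₂) : 0 ≤ hessForm q p p' β₀ β₁ β₂ := by
  obtain ⟨e1, e2⟩ := rpow_eq_rpow_sub_two_mul hβ₀ q
  have hP : 0 ≤ β₀ ^ (q - 2) := Real.rpow_nonneg hβ₀.le _
  rw [hessForm, e1, e2]
  generalize β₀ ^ (q - 2) = P at hP
  have h1 : 0 ≤ 2 * (1 + p ^ 2) * q * (β₀ * β₂ - β₁ ^ 2) := by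
    have := sub_nonneg.2 hβ; positivity
  have h2 : 4 * p ^ 2 * q ≤ (1 + p ^ 2) * (2 * q - 1) := by nlinarith
  -- After `β₀ ^ (q - 2)` is factored out, completing the square in `p'` leaves the Cauchy–Schwarz
  -- defect of `h1` and a multiple of `β₁²`. The bounds `q ≥ 2/3` and `p² ≤ 1/9` make the latter
  -- nonnegative.
  have h3 : 0 ≤ 2 * (β₀ * p' + 2 * p * q * β₁) ^ 2 +
      2 * q * ((1 + p ^ 2) * (2 * q - 1) - 4 * p ^ 2 * q) * β₁ ^ 2 := by
    have := sub_nonneg.2 h2; positivity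
  have := mul_nonneg hP (add_nonneg h1 h3)
  refine this.trans_eq ?_
  ring

/-- Convexity of `(1 + τ²)ρ^{2q}` in `(τ, ρ)` for `ρ ≥ 0`. Along a segment not contained in `ρ = 0`,
`ρ` is positive in the interior, so the second derivative can be used there; continuity handles the
endpoints. -/
lemma profile_le {q τ₀ τ₁ ρ₀ ρ₁ : ℝ} (hq : 2 / 3 ≤ q) (hq1 : q < 1)
    (hτ₀ : |τ₀| ≤ 1 / 3) (hτ₁ : |τ₁| ≤ 1 / 3) (hρ₀ : 0 ≤ ρ₀) (hρ₁ : 0 ≤ ρ₁)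
    {a b : ℝ} (ha : 0 ≤ a) (hb : 0 ≤ b) (hab : a + b = 1) :
    (1 + (a * τ₀ + b * τ₁) ^ 2) * ((a * ρ₀ + b * ρ₁) ^ 2) ^ q ≤
      a * ((1 + τ₀ ^ 2) * (ρ₀ ^ 2) ^ q) + b * ((1 + τ₁ ^ 2) * (ρ₁ ^ 2) ^ q) := by
  by_cases h0 : ρ₀ = 0 ∧ ρ₁ = 0
  · simp [h0.1, h0.2, Real.zero_rpow (show q ≠ 0 by linarith)]
  set g := profile q τ₀ (τ₁ - τ₀) (ρ₀ ^ 2) (ρ₀ * (ρ₁ - ρ₀)) ((ρ₁ - ρ₀) ^ 2) with hg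
  have hB : ∀ t, ρ₀ ^ 2 + 2 * (ρ₀ * (ρ₁ - ρ₀)) * t + (ρ₁ - ρ₀) ^ 2 * t ^ 2 =
      ((1 - t) * ρ₀ + t * ρ₁) ^ 2 := fun t => by ring
  have hpos : ∀ t ∈ Set.Ioo (0 : ℝ) 1,
      0 < ρ₀ ^ 2 + 2 * (ρ₀ * (ρ₁ - ρ₀)) * t + (ρ₁ - ρ₀) ^ 2 * t ^ 2 := by
    intro t ht
    rw [hB]
    have h1 : 0 < 1 - t := sub_pos.2 ht.2
    have h2 := ht.1
    rcases hρ₀.lt_or_eq with h | h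
    · positivity
    · have : 0 < ρ₁ := hρ₁.lt_of_ne fun h' => h0 ⟨h.symm, h'.symm⟩
      positivity
  have hconv : ConvexOn ℝ (Set.Icc 0 1) g := by
    have hd : ∀ t ∈ Set.Ioo (0 : ℝ) 1, deriv g t = profile₁ q τ₀ (τ₁ - τ₀) (ρ₀ ^ 2)
        (ρ₀ * (ρ₁ - ρ₀)) ((ρ₁ - ρ₀) ^ 2) t := fun t ht =>
      (hasDerivAt_profile _ _ _ _ _ _ (hpos t ht)).deriv
    have hd' : ∀ t ∈ Set.Ioo (0 : ℝ) 1, HasDerivAt (deriv g) _ t := fun t ht =>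
      (hasDerivAt_profile₁ q τ₀ (τ₁ - τ₀) (ρ₀ ^ 2) (ρ₀ * (ρ₁ - ρ₀)) ((ρ₁ - ρ₀) ^ 2)
        (hpos t ht)).congr_of_eventuallyEq (by
          filter_upwards [Ioo_mem_nhds ht.1 ht.2] with s hs using hd s hs)
    refine convexOn_of_deriv2_nonneg (convex_Icc 0 1) ?_ ?_ ?_ ?_
    · refine Continuous.continuousOn ?_
      rw [hg]
      unfold profile
      refine Continuous.mul (by fun_prop) ?_
      exact Continuous.rpow_const (by fun_prop) fun _ => Or.inr (by linarith)
    · rw [interior_Icc]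
      exact fun t ht => (hasDerivAt_profile _ _ _ _ _ _
        (hpos t ht)).differentiableAt.differentiableWithinAt
    · rw [interior_Icc]
      exact fun t ht => (hd' t ht).differentiableAt.differentiableWithinAt
    · rw [interior_Icc]
      intro t ht
      rw [Function.iterate_succ_apply, Function.iterate_one, (hd' t ht).deriv]
      refine hessForm_nonneg hq hq1 ?_ (hpos t ht) (le_of_eq ?_)
      · have h1 := abs_le.1 hτ₀
        have h2 := abs_le.1 hτ₁
        have h3 := ht.1
        have h4 := ht.2
        have h5 : τ₀ + t * (τ₁ - τ₀) ≤ 1 / 3 := by nlinarith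
        have h6 : -(1 / 3) ≤ τ₀ + t * (τ₁ - τ₀) := by nlinarith
        nlinarith
      · rw [hB]; ring
  have h := hconv.2 (Set.left_mem_Icc.2 zero_le_one) (Set.right_mem_Icc.2 zero_le_one) ha hb hab
  have hg0 : g 0 = (1 + τ₀ ^ 2) * (ρ₀ ^ 2) ^ q := by simp [hg, profile]
  have hg1 : g 1 = (1 + τ₁ ^ 2) * (ρ₁ ^ 2) ^ q := by
    rw [hg, profile, hB]; ring_nf
  have hgb : g b = (1 + (a * τ₀ + b * τ₁) ^ 2) * ((a * ρ₀ + b * ρ₁) ^ 2) ^ q := by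
    obtain rfl : a = 1 - b := by linarith
    rw [hg, profile, hB]; ring_nf
  rw [hg0, hg1, smul_eq_mul, smul_eq_mul, smul_eq_mul, smul_eq_mul, mul_zero, zero_add, mul_one,
    hgb] at h
  exact h

/-! ### The function `u`, its Hessian and the right-hand side -/

/-- The indices of the coordinates `x₂, …, x_{k-1}`. -/
def radIdx (n k : ℕ) : Finset (Fin n) :=
  Finset.univ.filter (fun i : Fin n => 2 ≤ (i : ℕ) + 1 ∧ (i : ℕ) + 1 ≤ k - 1)

/-- Half of the exponent of `pogorelov`. -/
def halfExp (k : ℕ) : ℝ := (2 - 2 / ((k : ℝ) - 1)) / 2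

/-- The scalar product in the coordinates `x₂, …, x_{k-1}`. -/
def radDot {n : ℕ} (k : ℕ) (x y : Fin n → ℝ) : ℝ := ∑ i ∈ radIdx n k, x i * y i

lemma pogorelov_eq {n : ℕ} (hn : 0 < n) (k : ℕ) (x : EuclideanSpace ℝ (Fin n)) :
    pogorelov hn k x = (1 + x ⟨0, hn⟩ ^ 2) * radDot k x x ^ halfExp k := by
  simp only [pogorelov, radDot, radIdx, halfExp, sq]

lemma zero_notMem_radIdx {n : ℕ} (hn : 0 < n) (k : ℕ) : (⟨0, hn⟩ : Fin n) ∉ radIdx n k := by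
  simp [radIdx]

lemma card_radIdx {n k : ℕ} (hk : 2 ≤ k) (hkn : k ≤ n + 1) : (radIdx n k).card = k - 2 := by
  have : (radIdx n k).map Fin.valEmbedding = Finset.Icc 1 (k - 2) := by
    ext i
    simp only [radIdx, Finset.mem_map, Finset.mem_filter, Finset.mem_univ, true_and,
      Fin.valEmbedding_apply, Finset.mem_Icc]
    constructor
    · rintro ⟨j, hj, rfl⟩; omega
    · intro hi; exact ⟨⟨i, by omega⟩, by simp only; omega, rfl⟩
  rw [← Finset.card_map Fin.valEmbedding, this, Nat.card_Icc]
  omega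

lemma halfExp_eq {k : ℕ} (hk : 4 ≤ k) : halfExp k * ((k : ℝ) - 1) = k - 2 := by
  have : (4 : ℝ) ≤ k := by exact_mod_cast hk
  have h : (k : ℝ) - 1 ≠ 0 := by linarith
  rw [halfExp]; field_simp; ring

lemma two_thirds_le_halfExp {k : ℕ} (hk : 4 ≤ k) : 2 / 3 ≤ halfExp k := by
  have h4 : (4 : ℝ) ≤ k := by exact_mod_cast hk
  have := halfExp_eq hk
  by_contra! h
  nlinarith

lemma halfExp_lt_one {k : ℕ} (hk : 4 ≤ k) : halfExp k < 1 := by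
  have h4 : (4 : ℝ) ≤ k := by exact_mod_cast hk
  have := halfExp_eq hk
  by_contra! h
  nlinarith

lemma radDot_self_nonneg {n : ℕ} (k : ℕ) (x : Fin n → ℝ) : 0 ≤ radDot k x x :=
  Finset.sum_nonneg fun i _ => mul_self_nonneg (x i)

lemma radDot_sq_le {n : ℕ} (k : ℕ) (x v : Fin n → ℝ) :
    radDot k x v ^ 2 ≤ radDot k x x * radDot k v v := by
  simpa only [radDot, sq] using Finset.sum_mul_sq_le_sq_mul_sq (radIdx n k) x v

lemma radDot_line {n : ℕ} (k : ℕ) (x v : Fin n → ℝ) (t : ℝ) :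
    radDot k (x + t • v) (x + t • v) =
      radDot k x x + 2 * radDot k x v * t + radDot k v v * t ^ 2 := by
  simp only [radDot, Pi.add_apply, Pi.smul_apply, smul_eq_mul, Finset.mul_sum, Finset.sum_mul,
    ← Finset.sum_add_distrib]
  exact Finset.sum_congr rfl fun i _ => by ring

lemma pogorelov_line {n : ℕ} (hn : 0 < n) (k : ℕ) (x : EuclideanSpace ℝ (Fin n)) (v : Fin n → ℝ)
    (t : ℝ) : pogorelov hn k (x + t • WithLp.toLp 2 v) =
      profile (halfExp k) (x ⟨0, hn⟩) (v ⟨0, hn⟩) (radDot k x x) (radDot k x v) (radDot k v v) t := by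
  rw [pogorelov_eq, profile, ← radDot_line]
  simp

/-- The Hessian matrix of `pogorelov` away from the singular set. -/
def pogHess {n : ℕ} (hn : 0 < n) (k : ℕ) (x : Fin n → ℝ) : Matrix (Fin n) (Fin n) ℝ :=
  Matrix.of fun i j =>
    (if i = j then (if i = ⟨0, hn⟩ then 2 * radDot k x x ^ halfExp k else
      if i ∈ radIdx n k then
        2 * (1 + x ⟨0, hn⟩ ^ 2) * halfExp k * radDot k x x ^ (halfExp k - 1) else 0) else 0) +
    4 * x ⟨0, hn⟩ * halfExp k * radDot k x x ^ (halfExp k - 1) *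
      ((if i = ⟨0, hn⟩ then 1 else 0) * (if j ∈ radIdx n k then x j else 0) +
        (if i ∈ radIdx n k then x i else 0) * (if j = ⟨0, hn⟩ then 1 else 0)) +
    4 * (1 + x ⟨0, hn⟩ ^ 2) * halfExp k * (halfExp k - 1) * radDot k x x ^ (halfExp k - 2) *
      ((if i ∈ radIdx n k then x i else 0) * (if j ∈ radIdx n k then x j else 0))

lemma pogHess_isHermitian {n : ℕ} (hn : 0 < n) (k : ℕ) (x : Fin n → ℝ) :
    (pogHess hn k x).IsHermitian := by
  ext i j
  simp only [pogHess, Matrix.conjTranspose_apply, Matrix.of_apply, star_trivial]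
  by_cases h : i = j
  · subst h; rfl
  · rw [if_neg h, if_neg (Ne.symm h)]; ring

lemma dotProduct_pogHess_mulVec {n : ℕ} (hn : 0 < n) (k : ℕ) (x v : Fin n → ℝ) :
    v ⬝ᵥ pogHess hn k x *ᵥ v = hessForm (halfExp k) (x ⟨0, hn⟩) (v ⟨0, hn⟩)
      (radDot k x x) (radDot k x v) (radDot k v v) := by
  rw [hessForm]
  have hz := zero_notMem_radIdx hn k
  have hxv : radDot k x v = ∑ j, (if j ∈ radIdx n k then x j else 0) * v j := by
    simp [radDot, ite_mul]
  have hvv : radDot k v v = ∑ j, if j ∈ radIdx n k then v j * v j else 0 := by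
    simp [radDot]
  have hv0 : v ⟨0, hn⟩ = ∑ j, (if j = ⟨0, hn⟩ then 1 else 0) * v j := by simp
  set q := halfExp k
  set s := radDot k x x with hs
  set i₀ : Fin n := ⟨0, hn⟩ with hi₀
  set a := 2 * s ^ q with ha
  set c := 2 * (1 + x i₀ ^ 2) * q * s ^ (q - 1) with hc
  set b := 4 * x i₀ * q * s ^ (q - 1) with hb
  set d := 4 * (1 + x i₀ ^ 2) * q * (q - 1) * s ^ (q - 2) with hd
  have hrow : ∀ i, (pogHess hn k x *ᵥ v) i =
      (if i = i₀ then a * v i else if i ∈ radIdx n k then c * v i else 0) +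
      b * ((if i = i₀ then 1 else 0) * radDot k x v +
        (if i ∈ radIdx n k then x i else 0) * v i₀) +
      d * ((if i ∈ radIdx n k then x i else 0) * radDot k x v) := by
    intro i
    have h1 : (if i = i₀ then a * v i else if i ∈ radIdx n k then c * v i else 0) =
        ∑ j, (if i = j then (if i = i₀ then a else if i ∈ radIdx n k then c else 0) else 0) *
          v j := by
      simp only [ite_mul, zero_mul, Finset.sum_ite_eq, Finset.mem_univ, if_true]
    rw [h1, hxv]
    conv_rhs => rw [hv0]
    simp only [mulVec, dotProduct, pogHess, Matrix.of_apply, Finset.mul_sum,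
      ← Finset.sum_add_distrib]
    exact Finset.sum_congr rfl fun j _ => by ring
  have hsum : v ⬝ᵥ pogHess hn k x *ᵥ v =
      (∑ i, (if i = i₀ then a * v i * v i else 0)) +
      c * (∑ i, if i ∈ radIdx n k then v i * v i else 0) +
      b * ((∑ i, (if i = i₀ then 1 else 0) * v i) * radDot k x v +
        (∑ i, (if i ∈ radIdx n k then x i else 0) * v i) * v i₀) +
      d * ((∑ i, (if i ∈ radIdx n k then x i else 0) * v i) * radDot k x v) := by
    simp only [dotProduct, hrow, Finset.mul_sum, Finset.sum_mul, ← Finset.sum_add_distrib]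
    refine Finset.sum_congr rfl fun i _ => ?_
    by_cases h : i = i₀
    · have : i ∉ radIdx n k := h ▸ hz
      simp only [if_pos h, if_neg this]; ring
    · simp only [if_neg h]
      split_ifs <;> ring
  rw [hsum, ← hvv, ← hv0, ← hxv]
  simp only [Finset.sum_ite_eq', Finset.mem_univ, if_true]
  rw [ha, hb, hc, hd]
  ring

/-- The right-hand side of the equation that `pogorelov` solves. -/
def pogRhs {n : ℕ} (hn : 0 < n) (k : ℕ) (x : EuclideanSpace ℝ (Fin n)) : ℝ :=
  (2 * (1 + x ⟨0, hn⟩ ^ 2) * halfExp k) ^ (k - 3) *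
    (4 * halfExp k * ((1 + x ⟨0, hn⟩ ^ 2) * (2 * halfExp k - 1) - 4 * x ⟨0, hn⟩ ^ 2 * halfExp k))

/-- The choice of `α` is made for this: the total exponent is `q(k-1) - (k-2) = 0`, so the block
determinant does not depend on `|x'|`. -/
lemma pow_rpow_cancel {k : ℕ} (hk : 4 ≤ k) {s : ℝ} (hs : 0 < s) :
    (s ^ (halfExp k - 1)) ^ (k - 3) * ((s ^ (halfExp k - 2)) ^ 2 * s ^ 3) = 1 := by
  rw [← Real.rpow_natCast s 3, ← Real.rpow_natCast _ (k - 3), ← Real.rpow_natCast _ 2,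
    ← Real.rpow_mul hs.le, ← Real.rpow_mul hs.le, ← Real.rpow_add hs, ← Real.rpow_add hs,
    Nat.cast_sub (by omega)]
  have : (halfExp k - 1) * ((k : ℝ) - (3 : ℕ)) + ((halfExp k - 2) * (2 : ℕ) + (3 : ℕ)) = 0 := by
    push_cast
    linear_combination halfExp_eq hk
  rw [this, Real.rpow_zero]

lemma S_eigs_pogHess {n k : ℕ} (hn : 0 < n) (hk : 4 ≤ k) (hkn : k ≤ n + 1)
    (x : EuclideanSpace ℝ (Fin n)) (hx : 0 < radDot k x x) :
    S k (eigs (pogHess hn k x)) = pogRhs hn k x := by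
  have hz := zero_notMem_radIdx hn k
  set i₀ : Fin n := ⟨0, hn⟩ with hi₀
  set K := insert i₀ (radIdx n k) with hK
  have hKc : K.card = k - 1 := by
    rw [hK, Finset.card_insert_of_notMem hz, card_radIdx (by omega) hkn]; omega
  have hrow : ∀ i ∉ K, ∀ j, pogHess hn k x i j = 0 := by
    intro i hi j
    rw [hK, Finset.mem_insert, not_or] at hi
    simp [pogHess, ← hi₀, hi.1, hi.2]
  rw [S_eigs_eq_det (by omega) (pogHess_isHermitian hn k x) K hKc hrow]
  have hq := two_thirds_le_halfExp hk
  have hq1 := halfExp_lt_one hk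
  have hcan := pow_rpow_cancel hk hx
  obtain ⟨e1, e2⟩ := rpow_eq_rpow_sub_two_mul hx (halfExp k)
  have hsum : ∑ i : K, (if (i : Fin n) ∈ radIdx n k then x i else 0) ^ 2 = radDot k x x := by
    rw [Finset.sum_coe_sort K (fun i => (if i ∈ radIdx n k then x i else 0) ^ 2), hK,
      Finset.sum_insert hz, if_neg hz, radDot]
    rw [zero_pow two_ne_zero, zero_add]
    exact Finset.sum_congr rfl fun i hi => by rw [if_pos hi, sq]
  have hP : 0 < radDot k x x ^ (halfExp k - 2) := Real.rpow_pos_of_pos hx _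
  have hq0 : 0 < halfExp k := by linarith
  have hdet := det_diagonal_add_rank_two (ι := K) ⟨i₀, Finset.mem_insert_self _ _⟩
    (fun i => if (i : Fin n) ∈ radIdx n k then x i else 0) (if_neg hz)
    (a := 2 * radDot k x x ^ halfExp k)
    (c := 2 * (1 + x i₀ ^ 2) * halfExp k * radDot k x x ^ (halfExp k - 1))
    (4 * x i₀ * halfExp k * radDot k x x ^ (halfExp k - 1))
    (4 * (1 + x i₀ ^ 2) * halfExp k * (halfExp k - 1) * radDot k x x ^ (halfExp k - 2))
    (by positivity) (by positivity)
  rw [hsum] at hdet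
  refine Eq.trans (congrArg Matrix.det ?_) (hdet.trans ?_)
  · refine Matrix.ext fun i j => ?_
    have hi : (i : Fin n) = i₀ ∨ (i : Fin n) ∈ radIdx n k := Finset.mem_insert.1 i.2
    have hi' : (if (i : Fin n) = i₀ then 2 * radDot k x x ^ halfExp k else
        if (i : Fin n) ∈ radIdx n k then
          2 * (1 + x i₀ ^ 2) * halfExp k * radDot k x x ^ (halfExp k - 1) else 0) =
        if (i : Fin n) = i₀ then 2 * radDot k x x ^ halfExp k else
          2 * (1 + x i₀ ^ 2) * halfExp k * radDot k x x ^ (halfExp k - 1) := by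
      split_ifs with h1 h2
      · rfl
      · rfl
      · exact absurd hi (by tauto)
    simp only [Matrix.submatrix_apply, pogHess, Matrix.of_apply, Subtype.ext_iff, ← hi₀, hi']
  rw [Fintype.card_coe, hKc, pogRhs, ← hi₀]
  obtain ⟨m, rfl⟩ : ∃ m, k = m + 3 := ⟨k - 3, by omega⟩
  rw [show m + 3 - 1 - 1 = m + 1 by omega]
  rw [Nat.add_sub_cancel] at hcan ⊢
  rw [e2] at hcan
  rw [e1, e2]
  generalize radDot (m + 3) x x ^ (halfExp (m + 3) - 2) = P at *
  generalize radDot (m + 3) x x = s at *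
  generalize halfExp (m + 3) = q at *
  generalize x i₀ = p
  have hc0 : 0 < 1 + p ^ 2 := by positivity
  calc _ = (2 * (1 + p ^ 2) * q) ^ m * (4 * q * ((1 + p ^ 2) * (2 * q - 1) - 4 * p ^ 2 * q)) *
        ((P * s) ^ m * (P ^ 2 * s ^ 3)) := by
        rw [pow_succ, ← mul_assoc (2 * (1 + p ^ 2) * q) P s, mul_pow _ s, mul_pow _ P, mul_pow P s]
        field_simp
        ring
    _ = _ := by rw [hcan, mul_one]

/-! ### Convexity, Lipschitz bound and positivity of the right-hand side -/

lemma abs_apply_lt_of_mem_ball {n : ℕ} {r : ℝ} {x : EuclideanSpace ℝ (Fin n)}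
    (hx : x ∈ Metric.ball 0 r) (i : Fin n) : |x i| < r :=
  lt_of_le_of_lt (PiLp.norm_apply_le x i) (mem_ball_zero_iff.1 hx)

lemma continuous_pogorelov {n k : ℕ} (hn : 0 < n) (hk : 4 ≤ k) :
    Continuous (pogorelov (n := n) hn k) := by
  have hq := two_thirds_le_halfExp hk
  rw [funext (pogorelov_eq hn k)]
  unfold radDot
  refine Continuous.mul (by fun_prop) ?_
  exact Continuous.rpow_const (by fun_prop) fun _ => Or.inr (by linarith)

/-- `u` is increasing in `|x'|`, and `|x'|` is convex, so the claim reduces to the two variables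
`x₁` and `|x'|`. -/
lemma convexOn_pogorelov {n k : ℕ} (hn : 0 < n) (hk : 4 ≤ k) :
    ConvexOn ℝ (Metric.ball 0 (1 / 3)) (pogorelov (n := n) hn k) := by
  refine ⟨convex_ball _ _, fun x hx y hy a b ha hb hab => ?_⟩
  have hq := two_thirds_le_halfExp hk
  have h := profile_le hq (halfExp_lt_one hk) (abs_apply_lt_of_mem_ball hx ⟨0, hn⟩).le
    (abs_apply_lt_of_mem_ball hy ⟨0, hn⟩).le (Real.sqrt_nonneg (radDot k x x))
    (Real.sqrt_nonneg (radDot k y y)) ha hb hab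
  rw [Real.sq_sqrt (radDot_self_nonneg k _), Real.sq_sqrt (radDot_self_nonneg k _)] at h
  rw [pogorelov_eq, pogorelov_eq, pogorelov_eq, smul_eq_mul, smul_eq_mul]
  refine le_trans ?_ h
  simp only [PiLp.add_apply, PiLp.smul_apply, smul_eq_mul]
  refine mul_le_mul_of_nonneg_left ?_ (by positivity)
  refine Real.rpow_le_rpow (radDot_self_nonneg k _) ?_ (by linarith)
  have hcs : radDot k x y ≤ √(radDot k x x) * √(radDot k y y) := by
    simpa only [radDot, sq] using Real.sum_mul_le_sqrt_mul_sqrt (radIdx n k) x y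
  have hexp : radDot k (a • x + b • y).ofLp (a • x + b • y).ofLp =
      a ^ 2 * radDot k x x + 2 * (a * b) * radDot k x y + b ^ 2 * radDot k y y := by
    simp only [radDot, PiLp.add_apply, PiLp.smul_apply, smul_eq_mul, Finset.mul_sum,
      ← Finset.sum_add_distrib]
    exact Finset.sum_congr rfl fun i _ => by ring
  have hx2 := Real.sq_sqrt (radDot_self_nonneg k x)
  have hy2 := Real.sq_sqrt (radDot_self_nonneg k y)
  rw [hexp]
  nlinarith [mul_le_mul_of_nonneg_left hcs (mul_nonneg ha hb)]

/-- A bounded convex function is Lipschitz on a smaller ball, which is why the radius drops from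
`1/3` to `1/4`. -/
lemma exists_lipschitzOnWith_pogorelov {n k : ℕ} (hn : 0 < n) (hk : 4 ≤ k) :
    ∃ K : NNReal, LipschitzOnWith K (pogorelov (n := n) hn k) (Metric.ball 0 (1 / 4)) := by
  refine (convexOn_pogorelov hn hk).exists_lipschitzOnWith_of_isBounded (by norm_num) ?_
  exact ((isCompact_closedBall (0 : EuclideanSpace ℝ (Fin n)) (1 / 3)).image
    (continuous_pogorelov hn hk)).isBounded.subset (Set.image_mono Metric.ball_subset_closedBall)

lemma contDiff_pogRhs {n : ℕ} (hn : 0 < n) (k : ℕ) : ContDiff ℝ ∞ (pogRhs (n := n) hn k) := by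
  unfold pogRhs
  fun_prop

lemma pogRhs_lower_bound {n k : ℕ} (hn : 0 < n) (hk : 4 ≤ k) {x : EuclideanSpace ℝ (Fin n)}
    (hx : x ∈ Metric.ball 0 (1 / 4)) : 1 / 3 ≤ pogRhs hn k x := by
  have hq := two_thirds_le_halfExp hk
  have hq1 := halfExp_lt_one hk
  have hp : x ⟨0, hn⟩ ^ 2 ≤ 1 / 16 := by
    have := abs_lt.1 (abs_apply_lt_of_mem_ball hx ⟨0, hn⟩)
    nlinarith
  rw [pogRhs]
  generalize x ⟨0, hn⟩ = p at hp
  generalize halfExp k = q at *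
  have h1 : 1 ≤ (2 * (1 + p ^ 2) * q) ^ (k - 3) := by
    refine one_le_pow₀ ?_
    nlinarith [sq_nonneg p]
  have h2 : 1 / 3 ≤ 4 * q * ((1 + p ^ 2) * (2 * q - 1) - 4 * p ^ 2 * q) := by
    have : 7 / 48 ≤ (1 + p ^ 2) * (2 * q - 1) - 4 * p ^ 2 * q := by nlinarith
    nlinarith
  nlinarith

/-! ### Test functions and the viscosity property -/

lemma eventually_hasDerivAt_pogorelov {n : ℕ} (hn : 0 < n) (k : ℕ) {x : EuclideanSpace ℝ (Fin n)}
    (hx : 0 < radDot k x x) (v : Fin n → ℝ) :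
    ∀ᶠ t in nhds 0, HasDerivAt (fun t : ℝ => pogorelov hn k (x + t • WithLp.toLp 2 v))
      (profile₁ (halfExp k) (x ⟨0, hn⟩) (v ⟨0, hn⟩) (radDot k x x) (radDot k x v)
        (radDot k v v) t) t := by
  rw [funext (pogorelov_line hn k x v)]
  have hc : Continuous fun t => radDot k x x + 2 * radDot k x v * t + radDot k v v * t ^ 2 := by
    fun_prop
  have := hc.continuousAt.eventually_mem (x := 0) (s := Set.Ioi 0)
    (isOpen_Ioi.mem_nhds (by simpa using hx))
  filter_upwards [this] with t ht using hasDerivAt_profile _ _ _ _ _ _ ht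

lemma hasDerivAt_profile₁_pogorelov {n : ℕ} (hn : 0 < n) (k : ℕ) {x : EuclideanSpace ℝ (Fin n)}
    (hx : 0 < radDot k x x) (v : Fin n → ℝ) :
    HasDerivAt (profile₁ (halfExp k) (x ⟨0, hn⟩) (v ⟨0, hn⟩) (radDot k x x) (radDot k x v)
        (radDot k v v)) (v ⬝ᵥ pogHess hn k x *ᵥ v) 0 := by
  rw [dotProduct_pogHess_mulVec]
  simpa using hasDerivAt_profile₁ (halfExp k) (x ⟨0, hn⟩) (v ⟨0, hn⟩) (radDot k x x)
    (radDot k x v) (radDot k v v) (t := 0) (by simpa using hx)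

lemma eq_zero_of_radDot_eq_zero {n k : ℕ} {x : Fin n → ℝ} (hx : radDot k x x = 0) {i : Fin n}
    (hi : i ∈ radIdx n k) : x i = 0 :=
  mul_self_eq_zero.1
    ((Finset.sum_eq_zero_iff_of_nonneg fun i _ => mul_self_nonneg (x i)).1 hx i hi)

lemma radDot_single {n k : ℕ} (x : Fin n → ℝ) {i : Fin n} (hi : i ∈ radIdx n k) :
    radDot k x (Pi.single i 1) = x i := by
  simp [radDot, Pi.single_apply, hi]

lemma exists_mem_radIdx {n k : ℕ} (hn : 4 ≤ n) (hk : 4 ≤ k) : ∃ i : Fin n, i ∈ radIdx n k :=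
  ⟨⟨1, by omega⟩, by simp [radIdx]; omega⟩

/-- A `C²` function cannot touch `pogorelov` from above on the singular set. -/
lemma not_isLocalMax_of_radDot_eq_zero {n k : ℕ} (hn0 : 0 < n) (hn : 4 ≤ n) (hk : 4 ≤ k)
    {φ : EuclideanSpace ℝ (Fin n) → ℝ} {x : EuclideanSpace ℝ (Fin n)} (hφ : ContDiffAt ℝ 2 φ x)
    (hx : radDot k x x = 0) :
    ¬ IsLocalMax (fun y => pogorelov hn0 k y - φ y) x := by
  intro hmax
  have hq := two_thirds_le_halfExp hk
  have hq1 := halfExp_lt_one hk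
  obtain ⟨i, hi⟩ := exists_mem_radIdx hn hk
  have hi0 : i ≠ ⟨0, hn0⟩ := fun h => zero_notMem_radIdx hn0 k (h ▸ hi)
  set v : Fin n → ℝ := Pi.single i 1 with hv
  have hvv : radDot k v v = 1 := by rw [hv, radDot_single _ hi, Pi.single_eq_same]
  have hxv : radDot k x v = 0 := by
    rw [hv, radDot_single _ hi]; exact eq_zero_of_radDot_eq_zero hx hi
  have hu : ∀ t : ℝ, pogorelov hn0 k (x + t • WithLp.toLp 2 v) =
      (1 + x ⟨0, hn0⟩ ^ 2) * (t ^ 2) ^ halfExp k := by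
    intro t
    rw [pogorelov_line, profile, hx, hxv, hvv]
    simp [hv, hi0.symm]
  set Q := v ⬝ᵥ hess φ x *ᵥ v
  -- The parabola `M t²` lies below `|t|^{2q}` near `0`, hence below `u` on this line; touching from
  -- above would give `2M ≤ Q`.
  set M := |Q| + 1 with hM
  have hMpos : 0 < M := by positivity
  have hsmall : ∀ᶠ t : ℝ in nhds 0, M * (t ^ 2) ^ (1 - halfExp k) < 1 := by
    have hc : Continuous fun t : ℝ => M * (t ^ 2) ^ (1 - halfExp k) :=
      continuous_const.mul (Continuous.rpow_const (by fun_prop) fun _ => Or.inr (by linarith))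
    refine hc.continuousAt.eventually_lt_const ?_
    simp [Real.zero_rpow (show 1 - halfExp k ≠ 0 by linarith)]
  have hle : ∀ᶠ t : ℝ in nhds 0, M * t ^ 2 ≤ pogorelov hn0 k (x + t • WithLp.toLp 2 v) := by
    filter_upwards [hsmall] with t ht
    rw [hu]
    have h1 : 0 ≤ (t ^ 2) ^ halfExp k := Real.rpow_nonneg (sq_nonneg t) _
    have h2 : t ^ 2 = (t ^ 2) ^ (1 - halfExp k) * (t ^ 2) ^ halfExp k := by
      rw [← Real.rpow_add_of_nonneg (sq_nonneg t) (by linarith) (by linarith)]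
      simp
    calc M * t ^ 2 = (M * (t ^ 2) ^ (1 - halfExp k)) * (t ^ 2) ^ halfExp k := by
          rw [mul_assoc, ← h2]
      _ ≤ 1 * (t ^ 2) ^ halfExp k := by gcongr
      _ ≤ (1 + x ⟨0, hn0⟩ ^ 2) * (t ^ 2) ^ halfExp k := by
          gcongr; linarith [sq_nonneg (x ⟨0, hn0⟩)]
  have hd : ∀ t : ℝ, HasDerivAt (fun t : ℝ => M * t ^ 2) (M * (2 * t)) t := fun t => by
    simpa using (hasDerivAt_pow 2 t).const_mul M
  have hd1 : HasDerivAt (fun t : ℝ => M * (2 * t)) (M * 2) 0 := by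
    simpa using ((hasDerivAt_id (0 : ℝ)).const_mul 2).const_mul M
  have hx0 : M * (0 : ℝ) ^ 2 = pogorelov hn0 k x := by
    have := hu 0
    rw [zero_smul, add_zero] at this
    rw [this]
    simp [Real.zero_rpow (show halfExp k ≠ 0 by linarith)]
  have := le_hess_of_isLocalMax hφ (Filter.Eventually.of_forall hd) hd1 hle hx0 hmax
  have h3 := le_abs_self Q
  linarith

/-- An admissible `C²` function cannot touch `pogorelov` from below on the singular set. -/
lemma eigs_notMem_GamTilde_of_radDot_eq_zero {n k : ℕ} (hn : 0 < n) (hk : 4 ≤ k) (hkn : k ≤ n + 1)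
    {φ : EuclideanSpace ℝ (Fin n) → ℝ} {x : EuclideanSpace ℝ (Fin n)} (hφ : ContDiffAt ℝ 2 φ x)
    (hx : radDot k x x = 0) (hmin : IsLocalMin (fun y => pogorelov hn k y - φ y) x) :
    eigs (hess φ x) ∉ GamTilde n k := by
  intro hmem
  have hH := hess_isHermitian hφ
  have hq := two_thirds_le_halfExp hk
  have hpos := le_card_pos_of_mem_GamTilde hmem
  rw [eigs_eq hH] at hpos
  -- `u` vanishes on every line through `x` that keeps `x' = 0`, so the Hessian form of `φ` is
  -- nonpositive on those `n - (k-2)` directions.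
  have hneg := card_pos_eigenvalues_add_card_le hH (radIdx n k)ᶜ (by
    intro v hv
    have hv' : ∀ i ∈ radIdx n k, v i = 0 := fun i hi => hv i (by simpa using hi)
    have hvv : radDot k v v = 0 := Finset.sum_eq_zero fun i hi => by rw [hv' i hi, zero_mul]
    have hxv : radDot k x v = 0 := Finset.sum_eq_zero fun i hi => by rw [hv' i hi, mul_zero]
    have hu : (fun t : ℝ => pogorelov hn k (x + t • WithLp.toLp 2 v)) = fun _ => 0 := by
      funext t
      rw [pogorelov_line, profile, hx, hxv, hvv]
      simp [Real.zero_rpow (show halfExp k ≠ 0 by linarith)]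
    refine hess_le_of_isLocalMin hφ (g₁ := fun _ => 0) ?_ (hasDerivAt_const _ _) hmin
    rw [hu]
    exact Filter.Eventually.of_forall fun t => hasDerivAt_const _ _)
  rw [Finset.card_compl, Fintype.card_fin, card_radIdx (by omega) hkn] at hneg
  omega

lemma isViscositySolution_pogorelov {n k : ℕ} (hn0 : 0 < n) (hn : 4 ≤ n) (hk : 4 ≤ k)
    (hkn : k ≤ n + 1) :
    IsViscositySolution k (Metric.ball 0 (1 / 4)) (pogRhs hn0 k) (pogorelov hn0 k) := by
  have hq := two_thirds_le_halfExp hk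
  have hq1 := halfExp_lt_one hk
  refine ⟨(continuous_pogorelov hn0 hk).continuousOn, ?_, ?_⟩
  · intro φ hφ x hx hmax
    have hφx : ContDiffAt ℝ 2 φ x := hφ.contDiffAt (Metric.isOpen_ball.mem_nhds hx)
    rcases (radDot_self_nonneg k x).eq_or_lt with h0 | hpos
    · exact absurd hmax (not_isLocalMax_of_radDot_eq_zero hn0 hn hk hφx h0.symm)
    rw [← S_eigs_pogHess hn0 hk hkn x hpos]
    have hA := pogHess_isHermitian hn0 k x
    refine S_mono_of_nonneg k (eigs_nonneg hA fun v => ?_)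
      (eigs_mono hA (hess_isHermitian hφx) fun v => ?_)
    · rw [dotProduct_pogHess_mulVec]
      refine hessForm_nonneg hq hq1 ?_ hpos (radDot_sq_le k _ _)
      have := abs_lt.1 (abs_apply_lt_of_mem_ball hx ⟨0, hn0⟩)
      nlinarith
    · exact le_hess_of_isLocalMax hφx (eventually_hasDerivAt_pogorelov hn0 k hpos v)
        (hasDerivAt_profile₁_pogorelov hn0 k hpos v)
        (Filter.Eventually.of_forall fun t => le_rfl) (by simp) hmax
  · intro φ hφ x hx hmin hmem
    have hφx : ContDiffAt ℝ 2 φ x := hφ.contDiffAt (Metric.isOpen_ball.mem_nhds hx)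
    rcases (radDot_self_nonneg k x).eq_or_lt with h0 | hpos
    · exact absurd hmem (eigs_notMem_GamTilde_of_radDot_eq_zero hn0 hk hkn hφx h0.symm hmin)
    rw [← S_eigs_pogHess hn0 hk hkn x hpos]
    refine S_mono_of_mem_GamTilde (by omega) hmem
      (eigs_mono (hess_isHermitian hφx) (pogHess_isHermitian hn0 k x) fun v => ?_)
    exact hess_le_of_isLocalMin hφx (eventually_hasDerivAt_pogorelov hn0 k hpos v)
      (hasDerivAt_profile₁_pogorelov hn0 k hpos v) hmin

/-- The gradient vanishes at the minimum point `0`, so Hölder continuity along an axis of `x'` would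
give `2q t^{2q-1} ≤ C t^q`, that is `2q ≤ C t^{1-q}`, which fails as `t → 0`. -/
lemma not_isC1Holder_pogorelov {n k : ℕ} (hn0 : 0 < n) (hn : 4 ≤ n) (hk : 4 ≤ k) {r : ℝ}
    (hr : 0 < r) {β : NNReal} (hβ : (β : ℝ) = halfExp k) :
    ¬ IsC1Holder β (Metric.ball 0 r) (pogorelov hn0 k) := by
  rintro ⟨hdiff, hhol⟩
  have hq := two_thirds_le_halfExp hk
  have hq1 := halfExp_lt_one hk
  obtain ⟨U, hU, C, hC⟩ := hhol 0 (Metric.mem_ball_self hr)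
  obtain ⟨i, hi⟩ := exists_mem_radIdx hn hk
  have hi0 : i ≠ ⟨0, hn0⟩ := fun h => zero_notMem_radIdx hn0 k (h ▸ hi)
  set u := pogorelov hn0 k with hu
  set v : Fin n → ℝ := Pi.single i 1 with hv
  set e : EuclideanSpace ℝ (Fin n) := WithLp.toLp 2 v with he
  have hne : ‖e‖ = 1 := by
    rw [he, hv, PiLp.toLp_single]; simp
  have hmin : IsLocalMin u 0 := by
    refine Filter.Eventually.of_forall fun y => ?_
    have h0 : u 0 = 0 := by
      rw [hu, pogorelov_eq]
      simp [radDot, Real.zero_rpow (show halfExp k ≠ 0 by linarith)]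
    rw [h0, hu, pogorelov_eq]
    exact mul_nonneg (by positivity) (Real.rpow_nonneg (radDot_self_nonneg k _) _)
  have hD0 : fderiv ℝ u 0 = 0 := hmin.fderiv_eq_zero
  have htend : Filter.Tendsto (fun t : ℝ => t • e) (nhdsWithin 0 (Set.Ioi 0)) (nhds 0) := by
    have : Filter.Tendsto (fun t : ℝ => t • e) (nhds 0) (nhds ((0 : ℝ) • e)) :=
      (continuous_id.smul continuous_const).tendsto 0
    rw [zero_smul] at this
    exact this.mono_left nhdsWithin_le_nhds
  have hball := Metric.isOpen_ball.mem_nhds (Metric.mem_ball_self (x := (0 : EuclideanSpace ℝ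
    (Fin n))) hr)
  have hmain : ∀ᶠ t : ℝ in nhdsWithin 0 (Set.Ioi 0), 2 * halfExp k ≤ C * t ^ (1 - halfExp k) := by
    filter_upwards [htend.eventually hU, htend.eventually hball, self_mem_nhdsWithin] with t htU htB
      ht
    have ht0 : 0 < t := ht
    have hvv : radDot k v v = 1 := by rw [hv, radDot_single _ hi, Pi.single_eq_same]
    have htv : radDot k (t • e).ofLp v = t := by
      rw [hv, radDot_single _ hi]; simp [he, hv]
    have htt : radDot k (t • e).ofLp (t • e).ofLp = t ^ 2 := by
      have := radDot_line k 0 v t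
      rw [hvv] at this
      simpa [radDot, he] using this
    have hx0 : (t • e).ofLp ⟨0, hn0⟩ = 0 := by simp [he, hv, hi0.symm]
    have hv0 : v ⟨0, hn0⟩ = 0 := by simp [hv, hi0.symm]
    have hd1 := (eventually_hasDerivAt_pogorelov hn0 k (x := t • e)
      (by rw [htt]; positivity) v).self_of_nhds
    have hdt : DifferentiableAt ℝ u (t • e) :=
      hdiff.differentiableAt (Metric.isOpen_ball.mem_nhds htB)
    have hd2 : HasDerivAt (fun s : ℝ => u (t • e + s • e)) (fderiv ℝ u (t • e) e) 0 := by
      have h : HasFDerivAt u (fderiv ℝ u (t • e)) (t • e + (0 : ℝ) • e) := by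
        simpa using hdt.hasFDerivAt
      exact h.comp_hasDerivAt 0 (hasDerivAt_line (t • e) e 0)
    have hval : fderiv ℝ u (t • e) e = 2 * halfExp k * t ^ (2 * halfExp k - 1) := by
      rw [hd2.unique hd1, htt, htv, hvv, hx0, hv0, profile₁]
      have e1 : t ^ (2 * halfExp k - 1) = t * (t ^ 2) ^ (halfExp k - 1) := by
        rw [← Real.rpow_natCast t 2, ← Real.rpow_mul ht0.le]
        nth_rewrite 2 [← Real.rpow_one t]
        rw [← Real.rpow_add ht0]
        congr 1; push_cast; ring
      rw [e1]
      simp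
      ring
    have hh := hC.dist_le ⟨htU, htB⟩ ⟨mem_of_mem_nhds hU, Metric.mem_ball_self hr⟩
    rw [hD0, dist_zero_right, dist_zero_right, norm_smul, hne, mul_one, Real.norm_eq_abs,
      abs_of_pos ht0, hβ] at hh
    have hop : fderiv ℝ u (t • e) e ≤ ‖fderiv ℝ u (t • e)‖ := by
      have := (le_abs_self _).trans ((fderiv ℝ u (t • e)).le_opNorm e)
      rwa [hne, mul_one] at this
    rw [hval] at hop
    have hfin := hop.trans hh
    have hpw : 0 < t ^ (2 * halfExp k - 1) := Real.rpow_pos_of_pos ht0 _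
    refine le_of_mul_le_mul_right (hfin.trans_eq ?_) hpw
    rw [mul_assoc, ← Real.rpow_add ht0]
    congr 2; ring
  have hlim : Filter.Tendsto (fun t : ℝ => C * t ^ (1 - halfExp k)) (nhdsWithin 0 (Set.Ioi 0))
      (nhds 0) := by
    have hc : Continuous fun t : ℝ => C * t ^ (1 - halfExp k) :=
      continuous_const.mul (Continuous.rpow_const continuous_id fun _ => Or.inr (by linarith))
    have := hc.tendsto 0
    simp only [Real.zero_rpow (show 1 - halfExp k ≠ 0 by linarith), mul_zero] at this
    exact this.mono_left nhdsWithin_le_nhds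
  have := ge_of_tendsto hlim hmain
  linarith

lemma S_eq_zero {n k : ℕ} (h : n + 1 < k) (v : Fin n → ℝ) : S k v = 0 := by
  rw [S, sigma_eq_zero (by omega), sigma_eq_zero (by omega), add_zero]

end SumHessian

end

theorem mainTheorem6 (n k : ℕ) (hn : 4 ≤ n) (hk : 4 ≤ k) :
    ∃ r : ℝ, 0 < r ∧ ∃ f u : EuclideanSpace ℝ (Fin n) → ℝ,
      ContDiffOn ℝ ∞ f (Metric.ball 0 r) ∧
      SumHessian.IsViscositySolution k (Metric.ball 0 r) f u ∧
      ConvexOn ℝ (Metric.ball 0 r) u ∧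
      (∃ K : NNReal, LipschitzOnWith K u (Metric.ball 0 r)) ∧
      (∃ β : NNReal, 0 < β ∧ β < 1 ∧ ¬ SumHessian.IsC1Holder β (Metric.ball 0 (r / 2)) u) ∧
      (k ≤ n + 1 →
        u = SumHessian.pogorelov (show 0 < n by omega) k ∧
        ∃ c : ℝ, 0 < c ∧ ∀ x ∈ Metric.ball (0 : EuclideanSpace ℝ (Fin n)) r, c ≤ f x) := by
  open SumHessian in
  have hn0 : 0 < n := by omega
  have hq := two_thirds_le_halfExp hk
  have hq1 := halfExp_lt_one hk
  have hsol : ∃ f : EuclideanSpace ℝ (Fin n) → ℝ, ContDiffOn ℝ ∞ f (Metric.ball 0 (1 / 4)) ∧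
      IsViscositySolution k (Metric.ball 0 (1 / 4)) f (pogorelov hn0 k) ∧
      (k ≤ n + 1 → ∃ c : ℝ, 0 < c ∧
        ∀ x ∈ Metric.ball (0 : EuclideanSpace ℝ (Fin n)) (1 / 4), c ≤ f x) := by
    rcases le_or_gt k (n + 1) with hkn | hkn
    · exact ⟨pogRhs hn0 k, (contDiff_pogRhs hn0 k).contDiffOn,
        isViscositySolution_pogorelov hn0 hn hk hkn, fun _ => ⟨1 / 3, by norm_num,
          fun x hx => pogRhs_lower_bound hn0 hk hx⟩⟩
    -- Here `S_k` is identically zero, so both viscosity inequalities read `0 ≤ 0`.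
    · exact ⟨fun _ => 0, contDiffOn_const,
        ⟨(continuous_pogorelov hn0 hk).continuousOn,
          fun φ _ x _ _ => (S_eq_zero hkn _).ge, fun φ _ x _ _ _ => (S_eq_zero hkn _).le⟩,
        fun h => absurd h (by omega)⟩
  obtain ⟨f, hf, hvisc, hlow⟩ := hsol
  have hβ : ((halfExp k).toNNReal : ℝ) = halfExp k := Real.coe_toNNReal _ (by linarith)
  refine ⟨1 / 4, by norm_num, f, pogorelov hn0 k, hf, hvisc,
    (convexOn_pogorelov hn0 hk).subset (Metric.ball_subset_ball (by norm_num)) (convex_ball _ _),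
    exists_lipschitzOnWith_pogorelov hn0 hk,
    ⟨(halfExp k).toNNReal, ?_, ?_, not_isC1Holder_pogorelov hn0 hn hk (by norm_num) hβ⟩,
    fun hkn => ⟨rfl, hlow hkn⟩⟩
  · exact Real.toNNReal_pos.2 (by linarith)
  · exact Real.toNNReal_lt_one.2 hq1
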